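/- Let $K$ be a field of characteristic $p>0$ equipped with a valuation $v\colon K^\ast\to G$ taking values in a (totally) ordered abelian group $G$, and suppose that the residue field $\mathcal O_K/\mathfrak m_K$ is finite with $q$ elements, where $\mathcal O_K=\{\alpha\in K: v(\alpha)\ge 0\}$ and $\mathfrak m_K=\{\alpha\in K: v(\alpha)>0\}$ (with the convention $v(0)=+\infty$). Let $\overline K$ be an algebraic closure of $K$, and fix an integer $d\ge 1$. If $k\ge 0$ and $f(x)=a_0x^{n_0}+a_1x^{n_1}+\cdots+a_kx^{n_k}$ is a polynomial with $k+1$ nonzero coefficients $a_0,\dots,a_k\in K^\ast$ and pairwise distinct exponents $n_0,\dots,n_k\ge 0$, then the number of distinct zeros of $f$ in $\overline K$ of degree at most $d$ over $K$ is at most $$\sum_{j=1}^{d}\ \sum_{i\mid j} \mu(j/i)\,q^{ik},$$ where $\mu$ is the Möbius function and the inner sum is over the positive divisors $i$ of $j$. -/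

import Mathlib

open Polynomial

/-! Extend the valuation to `Kbar`, with valuation ring `A` and residue field κ, and lift the
q-power map of κ to a K-automorphism φ of `Kbar` (`exists_valuationSubring_frobenius`). A conjugacy
class of degree at most d is permuted by φ, so an element of degree at most d is fixed by φ^j for
some 1 ≤ j ≤ d (`exists_pow_apply_eq_self`). It therefore suffices to embed the zeros of f into κ^k
so that a zero fixed by φ^e goes to a tuple fixed by the q^e-power map (`exists_address`): tuples of
Frobenius period at most d are counted by Möbius inversion (`card_exists_frobenius_fixed`).

The embedding records digits, with values written multiplicatively. A nonzero zero z is located in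
the tree of closed balls by its size |z| and by the radii r < |z| at which other zeros branch off
from it. At each such radius the digit is the residue of (z - c)/t, where c is a center of the ball
of radius r about z (0 if r = |z|) and |t| = r. Choosing c fixed by every power of φ that preserves
the ball, and t fixed by φ, makes digits compatible with Frobenius. Two distinct zeros of equal size
get distinct digits at the radius where they separate.

What remains is to fit all radii into k coordinates (`exists_branch_numbering`). Let S be the set of
exponents and δ(M) the dimension of the space of polynomials over F_p with exponents in S that
vanish at 1 to order at least M. In the Newton polygon of f about z, a radius r < |z| at which zeros
branch off spans indices l < L, and δ(L) < δ(l) (`finrank_relationSpace_lastMax_lt`). So δ(L)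
numbers these radii injectively; since z is a zero, l ≥ 1 and δ(l) ≤ k. Each size |z| receives a
still smaller number, because reducing the terms of f at z modulo the maximal ideal yields
independent relations for different sizes (`exists_slope_numbering`). -/

/-! ### Lifting Frobenius to an automorphism of the algebraic closure -/

/-- Over a valuation subring of an algebraic extension, every element is a fraction of elements
integral over the valuation ring of the base, with denominator a unit. -/
lemma exists_isIntegral_mul_eq_of_mem_valuationSubring {F E : Type*} [Field F] [Field E] [Algebra F E]
    [Algebra.IsAlgebraic F E] (A : ValuationSubring E) {x : E} (hx : x ∈ A) :
    ∃ b s : E, IsIntegral (A.comap (algebraMap F E)) b ∧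
      IsIntegral (A.comap (algebraMap F E)) s ∧ A.valuation s = 1 ∧ x * s = b := by
  obtain ⟨P, hP0, hP⟩ := Algebra.IsAlgebraic.isAlgebraic (R := F) x
  obtain ⟨i, hi, hmax⟩ := P.support.exists_max_image
    (fun i => A.valuation (algebraMap F E (P.coeff i))) (by simpa using hP0)
  have hci : P.coeff i ≠ 0 := by simpa using hi
  set b : ℕ → F := fun j => (P.coeff i)⁻¹ * P.coeff j with hb
  have hbA : ∀ j, algebraMap F E (b j) ∈ A := by
    intro j
    by_cases hj : j ∈ P.support
    · rw [← ValuationSubring.valuation_le_one_iff]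
      simp only [hb, map_mul, map_inv₀]
      have h0 : A.valuation (algebraMap F E (P.coeff i)) ≠ 0 := by simpa using hci
      calc _ ≤ (A.valuation (algebraMap F E (P.coeff i)))⁻¹ *
            A.valuation (algebraMap F E (P.coeff i)) := by gcongr; exact hmax j hj
        _ = 1 := inv_mul_cancel₀ h0
    · have : P.coeff j = 0 := by simpa using hj
      simp [hb, this, A.zero_mem]
  have hbi : b i = 1 := by simp [hb, hci]
  have hsum : ∑ j ∈ Finset.range (P.natDegree + 1), algebraMap F E (b j) * x ^ j = 0 := by
    have := hP
    rw [aeval_eq_sum_range] at this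
    simp only [hb, map_mul, mul_assoc, ← Finset.mul_sum]
    simp only [Algebra.smul_def] at this
    rw [this, mul_zero]
  -- Horner tails of the equation of x, normalised to have coefficients in `A` and coefficient 1 at
  -- `i`.
  set y : ℕ → E := fun j => ∑ m ∈ Finset.range (P.natDegree + 1), algebraMap F E (b (m + j)) * x ^ m
    with hy
  have hy0 : y 0 = 0 := by simpa [hy] using hsum
  have hrec : ∀ j, y j = algebraMap F E (b j) + x * y (j + 1) := by
    intro j
    have h1 : y j = ∑ m ∈ Finset.range (P.natDegree + 1 + 1),
        algebraMap F E (b (m + j)) * x ^ m := by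
      rw [Finset.sum_range_succ, hy]
      have : P.coeff (P.natDegree + 1 + j) = 0 := coeff_eq_zero_of_natDegree_lt (by lia)
      simp [hb, this]
    rw [h1, Finset.sum_range_succ', add_comm, hy, Finset.mul_sum]
    simp only [zero_add, pow_zero, mul_one]
    congr 1
    refine Finset.sum_congr rfl fun m _ => ?_
    rw [show m + 1 + j = m + (j + 1) by ring]; ring
  -- Integrality is tested on valuation rings V. If x ∈ V the tail is visibly in V; otherwise x⁻¹ ∈
  -- V and the recursion propagates membership upwards from y 0 = 0.
  have hyint : ∀ j, IsIntegral (A.comap (algebraMap F E)) (y j) := by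
    intro j
    by_contra hcon
    have : IsIntegrallyClosedIn (integralClosure (A.comap (algebraMap F E)) E).toSubring E :=
      inferInstanceAs (IsIntegrallyClosedIn (integralClosure (A.comap (algebraMap F E)) E) E)
    obtain ⟨V, hV, hjV⟩ := Subring.exists_le_valuationSubring_of_isIntegrallyClosedIn
      (R := (integralClosure (A.comap (algebraMap F E)) E).toSubring) (x := y j)
      (by simpa [mem_integralClosure_iff] using hcon)
    have hbV : ∀ j, algebraMap F E (b j) ∈ V := fun j =>
      hV (show algebraMap F E (b j) ∈ integralClosure (A.comap (algebraMap F E)) E from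
        (integralClosure (A.comap (algebraMap F E)) E).algebraMap_mem ⟨b j, hbA j⟩)
    apply hjV
    by_cases hxV : x ∈ V
    · exact sum_mem fun m _ => mul_mem (hbV _) (pow_mem hxV _)
    · have hx0 : x ≠ 0 := fun h => hxV (h ▸ V.zero_mem)
      have hxV' := (V.mem_or_inv_mem x).resolve_left hxV
      clear hjV hcon
      induction j with
      | zero => rw [hy0]; exact V.zero_mem
      | succ j ih =>
        have : y (j + 1) = x⁻¹ * (y j - algebraMap F E (b j)) := by
          rw [hrec j]; field_simp; ring
        rw [this]
        exact mul_mem hxV' (sub_mem ih (hbV j))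
  have hbint : ∀ j, IsIntegral (A.comap (algebraMap F E)) (algebraMap F E (b j)) := fun j =>
    isIntegral_algebraMap (R := A.comap (algebraMap F E)) (A := E) (x := ⟨b j, hbA j⟩)
  have hyA : ∀ j, y j ∈ A := fun j => sum_mem fun m _ => mul_mem (hbA _) (pow_mem hx _)
  have hxy : ∀ j, IsIntegral (A.comap (algebraMap F E)) (x * y (j + 1)) := fun j => by
    have : x * y (j + 1) = y j - algebraMap F E (b j) := by rw [hrec j]; ring
    rw [this]
    exact (hyint j).sub (hbint j)
  -- Since y i = 1 + x * y (i + 1), one of these two tails is a unit of `A` and serves as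
  -- denominator; in the second case i ≠ 0 because y 0 = 0.
  by_cases h1 : A.valuation (y (i + 1)) = 1
  · exact ⟨x * y (i + 1), y (i + 1), hxy i, hyint _, h1, rfl⟩
  · have h1' : A.valuation (y (i + 1)) < 1 :=
      lt_of_le_of_ne ((A.valuation_le_one_iff _).2 (hyA _)) h1
    have hvi : A.valuation (y i) = 1 := by
      rw [hrec i, hbi, map_one, Valuation.map_one_add_of_lt]
      rw [map_mul]
      exact mul_lt_one_of_nonneg_of_lt_one_right ((A.valuation_le_one_iff _).2 hx) zero_le h1'
    obtain _ | i := i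
    · simp [hy0] at hvi
    · exact ⟨x * y (i + 1), y (i + 1), hxy i, hyint _, hvi, rfl⟩

/-- If the `q`-power map is trivial modulo the valuation on the base of a Galois extension `E / F`
with `E` algebraically closed, it lifts to an automorphism of `E` on integral elements. -/
lemma exists_frobenius_of_isIntegral {F E : Type*} [Field F] [Field E] [Algebra F E] [IsGalois F E]
    [IsAlgClosed E] (p s : ℕ) [Fact p.Prime] [CharP E p] (A : ValuationSubring E)
    (h : ∀ x : F, algebraMap F E x ∈ A →
      A.valuation (algebraMap F E x ^ p ^ s - algebraMap F E x) < 1) :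
    ∃ φ : E ≃ₐ[F] E, ∀ b : E, IsIntegral (A.comap (algebraMap F E)) b →
      A.valuation (φ b - b ^ p ^ s) < 1 := by
  let O := A.comap (algebraMap F E)
  let B := integralClosure O E
  have : SMulCommClass (E ≃ₐ[F] E) O E := ⟨fun g r x => by
    have : r • (g • x) = (r : F) • (g x) := rfl
    rw [this, ← map_smul]; rfl⟩
  have hBA : ∀ b : B, (b : E) ∈ A := by
    intro b
    obtain ⟨P, hP, hb⟩ := b.2
    have : IsIntegral A (b : E) := by
      let i : O →+* A := ((algebraMap F E).comp O.subtype).codRestrict A.toSubring fun x => x.2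
      refine ⟨P.map i, hP.map i, ?_⟩
      rw [eval₂_map]
      exact hb
    obtain ⟨y, hy⟩ := IsIntegrallyClosed.isIntegral_iff.1 this
    rw [← hy]; exact y.2
  let i : B →+* A := (B.val.toRingHom).codRestrict A.toSubring hBA
  let Q : Ideal B := (IsLocalRing.maximalIdeal A).comap i
  have hQ : ∀ b : B, b ∈ Q ↔ A.valuation (b : E) < 1 := fun b => A.valuation_lt_one_iff (i b)
  let P : Ideal O := Q.under O
  have hchar : CharP (B ⧸ Q) p := by
    have : CharP B p := RingHom.charP B.val.toRingHom
      Subtype.val_injective p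
    exact charP_of_injective_ringHom
      (f := (Ideal.Quotient.mk Q).comp (ZMod.castHom dvd_rfl B)) (RingHom.injective _) p

  have hcomm : ∀ r : O ⧸ P, iterateFrobenius (B ⧸ Q) p s (algebraMap (O ⧸ P) (B ⧸ Q) r) =
      algebraMap (O ⧸ P) (B ⧸ Q) r := by
    intro r
    obtain ⟨r, rfl⟩ := Ideal.Quotient.mk_surjective r
    have : algebraMap (O ⧸ P) (B ⧸ Q) (Ideal.Quotient.mk P r) =
      Ideal.Quotient.mk Q (algebraMap O B r) := rfl
    rw [this, iterateFrobenius_def, ← map_pow, Ideal.Quotient.eq, hQ]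
    exact h r r.2
  let fr : (B ⧸ Q) →ₐ[O ⧸ P] (B ⧸ Q) := { iterateFrobenius (B ⧸ Q) p s with commutes' := hcomm }
  have hfr : Function.Bijective fr := by
    refine ⟨iterateFrobenius_inj (B ⧸ Q) p s, fun b => ?_⟩
    obtain ⟨b, rfl⟩ := Ideal.Quotient.mk_surjective b
    obtain ⟨c, hc⟩ := IsAlgClosed.exists_pow_nat_eq (b : E) (n := p ^ s)
      (pow_pos (Fact.out : p.Prime).pos s)
    have hcB : c ∈ B := by
      have : IsIntegral O (c ^ p ^ s) := hc ▸ b.2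
      exact this.of_pow (pow_pos (Fact.out : p.Prime).pos s)
    refine ⟨Ideal.Quotient.mk Q ⟨c, hcB⟩, ?_⟩
    change (Ideal.Quotient.mk Q ⟨c, hcB⟩) ^ p ^ s = _
    rw [← map_pow]
    congr 1
    exact Subtype.ext hc
  let σ : (B ⧸ Q) ≃ₐ[O ⧸ P] (B ⧸ Q) := AlgEquiv.ofBijective fr hfr
  let _ : TopologicalSpace B := ⊥
  have : DiscreteTopology B := ⟨rfl⟩
  have : ContinuousSMul (E ≃ₐ[F] E) B := by
    rw [continuousSMul_iff_stabilizer_isOpen]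
    intro b
    have : MulAction.stabilizer (E ≃ₐ[F] E) b = MulAction.stabilizer (E ≃ₐ[F] E) (b : E) := by
      ext g
      exact Subtype.ext_iff
    rw [this]
    exact stabilizer_isOpen_of_isIntegral (b : E)
  have : Algebra.IsInvariant O B (E ≃ₐ[F] E) := by
    refine ⟨fun b hb => ?_⟩
    obtain ⟨y, hy⟩ := (InfiniteGalois.mem_range_algebraMap_iff_fixed (k := F) (b : E)).2
      fun g => congrArg Subtype.val (hb g)
    exact ⟨⟨y, show algebraMap F E y ∈ A from hy ▸ hBA b⟩, Subtype.ext hy⟩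
  -- The decomposition group of Q surjects onto the automorphisms of B/Q over O/P, and the q-power
  -- map is one of them.
  obtain ⟨g, hg⟩ := Ideal.Quotient.stabilizerHom_surjective_of_profinite (G := E ≃ₐ[F] E) P Q σ
  refine ⟨g, fun b hb => ?_⟩
  have h1 := DFunLike.congr_fun hg (Ideal.Quotient.mk Q ⟨b, hb⟩)
  have h2 : Ideal.Quotient.mk Q ((g : E ≃ₐ[F] E) • (⟨b, hb⟩ : B)) =
      Ideal.Quotient.mk Q (⟨b, hb⟩ ^ p ^ s) := h1
  rw [Ideal.Quotient.eq, hQ] at h2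
  exact h2

/-- An algebraically closed algebraic extension `E` of a field `K` of characteristic `p` with a
valuation subring whose residue field is killed by `x ^ p ^ s - x` carries a valuation subring and
a `K`-automorphism that induces the `p ^ s`-power map on the residue field. -/
theorem exists_valuationSubring_frobenius {K E : Type*} [Field K] [Field E] [Algebra K E]
    [IsAlgClosed E] [Algebra.IsAlgebraic K E] (p s : ℕ) [Fact p.Prime] [CharP K p]
    (O : ValuationSubring K) (hO : ∀ x ∈ O, O.valuation (x ^ p ^ s - x) < 1) :
    ∃ (A : ValuationSubring E) (φ : E ≃ₐ[K] E),
      ∀ x ∈ A, A.valuation (φ x - x ^ p ^ s) < 1 := by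
  have : CharP E p := charP_of_injective_algebraMap (algebraMap K E).injective p
  obtain ⟨A, hA, hloc⟩ :=
    IsLocalRing.exists_factor_valuationRing ((algebraMap K E).comp O.subtype)
  have hOA : ∀ x, O.valuation x < 1 → A.valuation (algebraMap K E x) < 1 := by
    intro x hx
    have hxO : x ∈ O := (O.valuation_le_one_iff x).1 hx.le
    refine (A.valuation_lt_one_iff ⟨algebraMap K E x, hA ⟨x, hxO⟩⟩).1 ?_
    rw [IsLocalRing.mem_maximalIdeal]
    intro hu
    have h1 := hloc.map_nonunit ⟨x, hxO⟩ hu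
    rw [O.valuation_eq_one_iff] at h1
    exact hx.ne h1
  have hAO : ∀ x, algebraMap K E x ∈ A → x ∈ O := by
    intro x hx
    by_contra hxO
    have h1 : O.valuation x⁻¹ < 1 := by
      rw [map_inv₀]
      exact inv_lt_one_of_one_lt₀ (not_le.1 fun h => hxO ((O.valuation_le_one_iff x).1 h))
    have h2 := hOA _ h1
    rw [map_inv₀, map_inv₀] at h2
    have h3 := (A.valuation_le_one_iff _).2 hx
    have hx0 : A.valuation (algebraMap K E x) ≠ 0 := by
      simp only [ne_eq, map_eq_zero]
      rintro rfl
      exact hxO O.zero_mem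
    exact absurd ((inv_lt_one₀ (zero_lt_iff.2 hx0)).1 h2) (not_lt.2 h3)
  have : ExpChar K p := ExpChar.prime Fact.out
  have : ExpChar E p := ExpChar.prime Fact.out
  -- K need not be perfect, so E/K need not be Galois, whereas E/F is. The hypothesis on residues
  -- passes to F because x ^ p ^ n ∈ K for some n, and (x^q - x)^(p^n) = y^q - y with y = x^(p^n).
  let F := perfectClosure K E
  have : Algebra.IsAlgebraic F E := Algebra.IsAlgebraic.tower_top (K := K) F
  have : IsAlgClosure F E := ⟨‹_›, ‹_›⟩
  have : Normal F E := IsAlgClosure.normal F E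
  have : IsGalois F E := ⟨⟩
  obtain ⟨φ, hφ⟩ := exists_frobenius_of_isIntegral (F := F) p s A (by
    intro x hx
    obtain ⟨n, y, hy⟩ := (mem_perfectClosure_iff_pow_mem p).1 x.2
    have hyO : y ∈ O := hAO y (by rw [hy]; exact pow_mem hx _)
    have h1 := hOA _ (hO y hyO)
    rw [map_sub, map_pow, hy, ← pow_mul, mul_comm, pow_mul, ← sub_pow_expChar_pow, map_pow] at h1
    exact lt_of_not_ge fun h => absurd h1 (not_lt.2 (one_le_pow₀ h)))
  refine ⟨A, φ.restrictScalars K, fun x hx => ?_⟩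
  obtain ⟨b, t, hb, ht, ht1, rfl⟩ := exists_isIntegral_mul_eq_of_mem_valuationSubring (F := F) A hx
  have h1 := hφ _ hb
  have h2 := hφ _ ht
  change A.valuation (φ x - x ^ p ^ s) < 1
  have h3 : A.valuation (φ t) = 1 := by
    have : φ t = t ^ p ^ s + (φ t - t ^ p ^ s) := by ring
    rw [this, Valuation.map_add_eq_of_lt_left] <;> simp [map_pow, ht1]
    exact h2
  have h4 : (φ x - x ^ p ^ s) * φ t =
      (φ (x * t) - (x * t) ^ p ^ s) + x ^ p ^ s * (-(φ t - t ^ p ^ s)) := by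
    rw [map_mul]; ring
  have h5 : A.valuation (φ x - x ^ p ^ s) = A.valuation ((φ x - x ^ p ^ s) * φ t) := by
    rw [map_mul, h3, mul_one]
  rw [h5, h4]
  refine Valuation.map_add_lt _ h1 ?_
  rw [map_mul, Valuation.map_neg]
  exact mul_lt_one_of_nonneg_of_lt_one_right
    ((A.valuation_le_one_iff _).2 (pow_mem hx _)) zero_le h2

/-! ### Frobenius lifts: invariance of the valuation, fixed elements and fixed centers -/

/-- The endomorphism `φ` is locally of finite order and induces the `q`-power map on the residue
field of the valuation subring `A`. -/
structure IsFrobeniusLift {E : Type*} [Field E] (A : ValuationSubring E) (φ : E →+* E) (q : ℕ) :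
    Prop where
  val_sub_lt : ∀ x ∈ A, A.valuation (φ x - x ^ q) < 1
  periodic : ∀ x, ∃ a, 0 < a ∧ (φ ^ a) x = x

namespace IsFrobeniusLift

variable {E : Type*} [Field E] {A : ValuationSubring E} {φ : E →+* E} {p s : ℕ}

lemma pow_add_apply (φ : E →+* E) (a b : ℕ) (x : E) : (φ ^ (a + b)) x = (φ ^ a) ((φ ^ b) x) := by
  rw [pow_add]; rfl

lemma pow_succ_apply (φ : E →+* E) (a : ℕ) (x : E) : (φ ^ (a + 1)) x = φ ((φ ^ a) x) := by
  rw [pow_succ']; rfl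

lemma val_map_le_one {q : ℕ} (h : IsFrobeniusLift A φ q) {x : E} (hx : A.valuation x ≤ 1) :
    A.valuation (φ x) ≤ 1 := by
  have h1 := h.val_sub_lt x ((A.valuation_le_one_iff x).1 hx)
  have : φ x = (φ x - x ^ q) + x ^ q := by ring
  rw [this]
  refine Valuation.map_add_le _ h1.le ?_
  rw [map_pow]
  exact pow_le_one₀ zero_le hx

lemma val_map_mono {q : ℕ} (h : IsFrobeniusLift A φ q) {x y : E}
    (hxy : A.valuation x ≤ A.valuation y) : A.valuation (φ x) ≤ A.valuation (φ y) := by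
  obtain ⟨a, rfl⟩ := (A.valuation_le_iff x y).1 hxy
  rw [map_mul, map_mul]
  exact mul_le_of_le_one_left' (h.val_map_le_one (A.valuation_le_one a))

/-- φ is monotone for the valuation, so a strict change of value at x could never be undone along
its finite orbit. -/
lemma val_map {q : ℕ} (h : IsFrobeniusLift A φ q) (x : E) :
    A.valuation (φ x) = A.valuation x := by
  obtain ⟨a, ha, hx⟩ := h.periodic x
  obtain ⟨a, rfl⟩ := Nat.exists_eq_succ_of_ne_zero ha.ne'
  rcases le_total (A.valuation (φ x)) (A.valuation x) with hle | hle
  · refine le_antisymm hle ?_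
    have : ∀ m : ℕ, A.valuation ((φ ^ (m + 1)) x) ≤ A.valuation (φ x) := by
      intro m
      induction m with
      | zero => simp
      | succ m ih => rw [pow_succ_apply]; exact h.val_map_mono (ih.trans hle)
    have h2 := this a
    rwa [← Nat.succ_eq_add_one, hx] at h2
  · refine le_antisymm ?_ hle
    have : ∀ m : ℕ, A.valuation (φ x) ≤ A.valuation ((φ ^ (m + 1)) x) := by
      intro m
      induction m with
      | zero => simp
      | succ m ih => rw [pow_succ_apply]; exact h.val_map_mono (hle.trans ih)
    have h2 := this a
    rwa [← Nat.succ_eq_add_one, hx] at h2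

lemma val_pow_map {q : ℕ} (h : IsFrobeniusLift A φ q) (e : ℕ) (x : E) :
    A.valuation ((φ ^ e) x) = A.valuation x := by
  induction e with
  | zero => simp
  | succ e ih => rw [pow_succ_apply, h.val_map, ih]

section Char

variable [Fact p.Prime] [CharP E p]

lemma val_pow_map_sub_lt (h : IsFrobeniusLift A φ (p ^ s)) (e : ℕ) {x : E} (hx : x ∈ A) :
    A.valuation ((φ ^ e) x - x ^ (p ^ s) ^ e) < 1 := by
  have : ExpChar E p := ExpChar.prime Fact.out
  induction e with
  | zero => simp
  | succ e ih =>
    have hxe : (φ ^ e) x ∈ A := by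
      rw [← A.valuation_le_one_iff, h.val_pow_map]
      exact (A.valuation_le_one_iff x).2 hx
    have h1 : (φ ^ (e + 1)) x - x ^ (p ^ s) ^ (e + 1) =
        (φ ((φ ^ e) x) - ((φ ^ e) x) ^ p ^ s) + ((φ ^ e) x - x ^ (p ^ s) ^ e) ^ p ^ s := by
      rw [pow_succ_apply, sub_pow_expChar_pow, pow_succ (p ^ s) e, pow_mul x]; ring
    rw [h1]
    refine Valuation.map_add_lt _ (h.val_sub_lt _ hxe) ?_
    rw [map_pow]
    exact pow_lt_one₀ zero_le ih (pow_pos (Fact.out : p.Prime).pos s).ne'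

omit [Fact p.Prime] [CharP E p] in
lemma val_eq_one_of_pow_eq (A : ValuationSubring E) {x : E} {m : ℕ} (hm : 1 < m)
    (hx : x ^ m = x) (hx0 : x ≠ 0) : A.valuation x = 1 := by
  have h1 : x ^ (m - 1) = 1 := by
    have : x ^ (m - 1) * x = 1 * x := by
      rw [← pow_succ, Nat.sub_add_cancel hm.le, hx, one_mul]
    exact mul_right_cancel₀ hx0 this
  have h2 : A.valuation x ^ (m - 1) = 1 := by rw [← map_pow, h1, map_one]
  exact (pow_eq_one_iff_of_nonneg zero_le (by lia)).1 h2

omit [Fact p.Prime] [CharP E p] in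
lemma val_le_one_of_pow_eq (A : ValuationSubring E) {x : E} {m : ℕ} (hm : 1 < m)
    (hx : x ^ m = x) : A.valuation x ≤ 1 := by
  by_cases h : x = 0
  · simp [h]
  · exact (val_eq_one_of_pow_eq A hm hx h).le

lemma val_sub_eq_one_of_pow_eq (A : ValuationSubring E) {x y : E} {n : ℕ} (hn : n ≠ 0)
    (hx : x ^ p ^ n = x) (hy : y ^ p ^ n = y) (hxy : x ≠ y) : A.valuation (x - y) = 1 := by
  have : ExpChar E p := ExpChar.prime Fact.out
  refine val_eq_one_of_pow_eq A (Nat.one_lt_pow hn (Fact.out : p.Prime).one_lt) ?_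
    (sub_ne_zero.2 hxy)
  rw [sub_pow_expChar_pow, hx, hy]

/-- Both sides lie in the finite field of order p^n inside E, whose distinct elements stay distinct
modulo the maximal ideal, and they agree there. -/
lemma map_eq_pow_of_pow_eq (h : IsFrobeniusLift A φ (p ^ s)) {x : E} {n : ℕ} (hn : n ≠ 0)
    (hx : x ^ p ^ n = x) : φ x = x ^ p ^ s := by
  by_contra hne
  have h1 := h.val_sub_lt x ((A.valuation_le_one_iff x).1
    (val_le_one_of_pow_eq A (Nat.one_lt_pow hn (Fact.out : p.Prime).one_lt) hx))
  refine h1.ne (val_sub_eq_one_of_pow_eq (p := p) A hn ?_ ?_ hne)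
  · rw [← map_pow, hx]
  · rw [← pow_mul, mul_comm, pow_mul, hx]

lemma pow_map_eq_pow_of_pow_eq (h : IsFrobeniusLift A φ (p ^ s)) {x : E} {n : ℕ} (hn : n ≠ 0)
    (hx : x ^ p ^ n = x) (e : ℕ) : (φ ^ e) x = x ^ (p ^ s) ^ e := by
  induction e with
  | zero => simp
  | succ e ih =>
    rw [pow_succ_apply, ih, map_pow, h.map_eq_pow_of_pow_eq hn hx, ← pow_mul, pow_succ, mul_comm]

lemma card_pow_eq_self [IsAlgClosed E] {n : ℕ} (hn : n ≠ 0) :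
    ∃ T : Finset E, T.card = p ^ n ∧ ∀ x, x ∈ T ↔ x ^ p ^ n = x := by
  classical
  have hp := (Fact.out : p.Prime).one_lt
  have hpn : 1 < p ^ n := Nat.one_lt_pow hn hp
  refine ⟨(X ^ p ^ n - X : E[X]).roots.toFinset, ?_, fun x => ?_⟩
  · rw [Multiset.toFinset_card_of_nodup]
    · rw [IsAlgClosed.card_roots_eq_natDegree, FiniteField.X_pow_card_sub_X_natDegree_eq E hpn]
    · exact nodup_roots (galois_poly_separable p (p ^ n) (dvd_pow_self p hn))
  · rw [Multiset.mem_toFinset, mem_roots (FiniteField.X_pow_card_sub_X_ne_zero E hpn)]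
    simp [sub_eq_zero]

/-- A twisted trace from the finite field of order q^(en) in E, where φ acts as the q-power map,
cannot vanish identically modulo the maximal ideal: a polynomial of degree less than q^(en) would
have too many roots. Traces of unit value replace division by an orbit length, which p may divide.
-/
lemma exists_val_sum_eq_one [IsAlgClosed E] (h : IsFrobeniusLift A φ (p ^ s)) (hs : s ≠ 0)
    {e n : ℕ} (he : 0 < e) (hn : 0 < n) (r : ℕ → E) (hr : ∀ i, A.valuation (r i) = 1) :
    ∃ x, (φ ^ (e * n)) x = x ∧ A.valuation x ≤ 1 ∧
      A.valuation (∑ i ∈ Finset.range n, (φ ^ (e * i)) x * r i) = 1 := by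
  have hp := (Fact.out : p.Prime).one_lt
  have hq : 1 < p ^ s := Nat.one_lt_pow hs hp
  have hsn : s * (e * n) ≠ 0 := by positivity
  obtain ⟨T, hTcard, hT⟩ := card_pow_eq_self (E := E) (p := p) hsn
  have hTA : ∀ x ∈ T, A.valuation x ≤ 1 := fun x hx =>
    val_le_one_of_pow_eq A (Nat.one_lt_pow hsn hp) ((hT x).1 hx)
  have hTφ : ∀ x ∈ T, ∀ m, (φ ^ m) x = x ^ (p ^ s) ^ m := fun x hx m =>
    h.pow_map_eq_pow_of_pow_eq hsn ((hT x).1 hx) m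
  have hrA : ∀ i, r i ∈ A := fun i => (A.valuation_le_one_iff _).1 (hr i).le
  have hsumle : ∀ x ∈ T, A.valuation (∑ i ∈ Finset.range n, (φ ^ (e * i)) x * r i) ≤ 1 := by
    intro x hx
    refine Valuation.map_sum_le _ fun i _ => ?_
    rw [map_mul, h.val_pow_map, hr, mul_one]
    exact hTA x hx
  suffices ∃ x ∈ T, A.valuation (∑ i ∈ Finset.range n, (φ ^ (e * i)) x * r i) = 1 by
    obtain ⟨x, hx, hx1⟩ := this
    refine ⟨x, ?_, hTA x hx, hx1⟩
    rw [hTφ x hx, ← pow_mul, (hT x).1 hx]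
  by_contra! hcon
  let κ := IsLocalRing.ResidueField A
  let P : κ[X] := ∑ i ∈ Finset.range n,
    C (IsLocalRing.residue A ⟨r i, hrA i⟩) * X ^ (p ^ s) ^ (e * i)
  have hP0 : P = 0 := by
    refine eq_zero_of_natDegree_lt_card_of_eval_eq_zero P
      (f := fun x : T => IsLocalRing.residue A ⟨x, (A.valuation_le_one_iff _).1 (hTA x x.2)⟩)
      ?_ ?_ ?_
    · intro x y hxy
      by_contra hne
      have h1 := val_sub_eq_one_of_pow_eq (p := p) A hsn ((hT x).1 x.2) ((hT y).1 y.2)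
        (fun h => hne (Subtype.ext h))
      have h2 := (A.valuation_lt_one_iff _).1 (Ideal.Quotient.eq.1 hxy)
      exact h2.ne h1
    · rintro ⟨x, hx⟩
      have hxA := (A.valuation_le_one_iff _).1 (hTA x hx)
      have h1 : eval (IsLocalRing.residue A ⟨x, hxA⟩) P = IsLocalRing.residue A
          (∑ i ∈ Finset.range n, ⟨x, hxA⟩ ^ (p ^ s) ^ (e * i) * ⟨r i, hrA i⟩) := by
        simp only [P, eval_finsetSum, map_sum, map_mul, map_pow, eval_mul, eval_C, eval_pow, eval_X]
        exact Finset.sum_congr rfl fun i _ => mul_comm _ _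
      rw [h1, IsLocalRing.residue_eq_zero_iff, A.valuation_lt_one_iff]
      have h2 := lt_of_le_of_ne (hsumle x hx) (hcon x hx)
      have h3 : ∑ i ∈ Finset.range n, (φ ^ (e * i)) x * r i =
          ∑ i ∈ Finset.range n, x ^ (p ^ s) ^ (e * i) * r i :=
        Finset.sum_congr rfl fun i _ => by rw [hTφ x hx]
      rw [h3] at h2
      convert h2 using 2
      push_cast
      rfl
    · rw [Fintype.card_coe, hTcard]
      refine (natDegree_sum_le_of_forall_le (n := (p ^ s) ^ (e * (n - 1))) _ _ fun i hi => ?_).trans_lt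
        ?_
      · refine (natDegree_C_mul_X_pow_le _ _).trans (Nat.pow_le_pow_right (by lia) ?_)
        have := Finset.mem_range.1 hi
        gcongr
        lia
      · rw [pow_mul p]
        refine Nat.pow_lt_pow_right hq ?_
        gcongr
        lia
  have h1 : P.coeff 1 = IsLocalRing.residue A ⟨r 0, hrA 0⟩ := by
    simp only [P, finsetSum_coeff, coeff_C_mul, coeff_X_pow]
    rw [Finset.sum_eq_single 0]
    · simp
    · intro i _ hi
      have : 1 < (p ^ s) ^ (e * i) := Nat.one_lt_pow (by positivity) hq
      simp [this.ne]
    · intro h0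
      exact absurd (Finset.mem_range.2 hn) h0
  rw [hP0, coeff_zero, eq_comm, IsLocalRing.residue_eq_zero_iff, A.valuation_lt_one_iff] at h1
  exact h1.ne (hr 0)

omit [Fact p.Prime] [CharP E p] in
lemma map_sum_orbit {e n : ℕ} {x : E} (hx : (φ ^ (e * n)) x = x) :
    (φ ^ e) (∑ i ∈ Finset.range n, (φ ^ (e * i)) x) = ∑ i ∈ Finset.range n, (φ ^ (e * i)) x := by
  rw [map_sum]
  have h1 : ∀ i, (φ ^ e) ((φ ^ (e * i)) x) = (φ ^ (e * (i + 1))) x := fun i => by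
    rw [← pow_add_apply]; congr 2; ring
  simp only [h1]
  have h2 := Finset.sum_range_succ (fun i => (φ ^ (e * i)) x) n
  rw [Finset.sum_range_succ', hx] at h2
  simpa using h2

omit [Fact p.Prime] [CharP E p] in
lemma pow_mul_apply_eq_self {e : ℕ} {x : E} (hx : (φ ^ e) x = x) (m : ℕ) :
    (φ ^ (e * m)) x = x := by
  induction m with
  | zero => simp
  | succ m ih => rw [mul_add_one, pow_add_apply, hx, ih]

/-- The orbit sum of y * x is φ-fixed and equals x times a twisted trace of y with the unit weights
φ^i(x)/x; choose y making that trace a unit. -/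
lemma exists_fixed_val_eq [IsAlgClosed E] (h : IsFrobeniusLift A φ (p ^ s)) (hs : s ≠ 0) {x : E}
    (hx : x ≠ 0) : ∃ t, A.valuation t = A.valuation x ∧ φ t = t := by
  obtain ⟨a, ha, hxa⟩ := h.periodic x
  have hvx : A.valuation x ≠ 0 := by simpa using hx
  obtain ⟨y, hy, -, hy1⟩ := h.exists_val_sum_eq_one hs one_pos ha (fun i => (φ ^ i) x / x)
    fun i => by rw [map_div₀, h.val_pow_map, div_self hvx]
  refine ⟨∑ i ∈ Finset.range a, (φ ^ (1 * i)) (y * x), ?_, ?_⟩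
  · have : ∑ i ∈ Finset.range a, (φ ^ (1 * i)) (y * x) =
        (∑ i ∈ Finset.range a, (φ ^ (1 * i)) y * ((φ ^ i) x / x)) * x := by
      rw [Finset.sum_mul]
      refine Finset.sum_congr rfl fun i _ => ?_
      rw [map_mul, one_mul]
      field_simp
    rw [this, map_mul, hy1, one_mul]
  · have := map_sum_orbit (φ := φ) (e := 1) (n := a) (x := y * x) (by
      rw [map_mul, hy, one_mul, hxa])
    simpa using this

/-- The exponents preserving the ball about z are the multiples of a least e > 0. The center is the
average of the φ^e-orbit of z with weights φ^(ei)(y), where y is chosen so that the total weight is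
a unit. -/
lemma exists_center [IsAlgClosed E] (h : IsFrobeniusLift A φ (p ^ s)) (hs : s ≠ 0) (z : E)
    (r : A.ValueGroup) : ∃ c, A.valuation (c - z) ≤ r ∧
      ∀ e, A.valuation ((φ ^ e) z - z) ≤ r → (φ ^ e) c = c := by
  classical
  have hex : ∃ e, 0 < e ∧ A.valuation ((φ ^ e) z - z) ≤ r := by
    obtain ⟨a, ha, hz⟩ := h.periodic z
    exact ⟨a, ha, by simp [hz]⟩
  obtain ⟨he, her⟩ := Nat.find_spec hex
  have hmin := fun m hm => Nat.find_min hex (m := m) hm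
  set e := Nat.find hex
  have hsub : ∀ x y w : E, A.valuation (x - y) ≤ r → A.valuation (y - w) ≤ r →
      A.valuation (x - w) ≤ r := by
    intro x y w h1 h2
    rw [← sub_add_sub_cancel x y w]
    exact Valuation.map_add_le _ h1 h2
  have hmul : ∀ m, A.valuation ((φ ^ (e * m)) z - z) ≤ r := by
    intro m
    induction m with
    | zero => simp
    | succ m ih =>
      refine hsub _ ((φ ^ (e * m)) z) _ ?_ ih
      rw [mul_add_one, pow_add_apply, ← map_sub, h.val_pow_map]
      exact her
  have hdvd : ∀ m, A.valuation ((φ ^ m) z - z) ≤ r → e ∣ m := by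
    intro m hm
    rw [Nat.dvd_iff_mod_eq_zero]
    by_contra h0
    refine hmin _ (Nat.mod_lt m he) ⟨Nat.pos_of_ne_zero h0, ?_⟩
    rw [← h.val_pow_map (e * (m / e)), map_sub, ← pow_add_apply, Nat.div_add_mod]
    refine hsub _ z _ hm ?_
    rw [Valuation.map_sub_swap]
    exact hmul _
  obtain ⟨a, ha, hza⟩ := h.periodic z
  obtain ⟨n, rfl⟩ := hdvd a (by simp [hza])
  have hn : 0 < n := Nat.pos_of_mul_pos_left ha
  obtain ⟨y, hy, hyle, hy1⟩ := h.exists_val_sum_eq_one hs he hn (fun _ => 1) fun i => by simp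
  simp only [mul_one] at hy1
  set t := ∑ i ∈ Finset.range n, (φ ^ (e * i)) y with ht
  have ht0 : t ≠ 0 := by
    rintro h0
    rw [h0] at hy1
    simp at hy1
  have hfix : (φ ^ e) ((∑ i ∈ Finset.range n, (φ ^ (e * i)) (y * z)) / t) =
      (∑ i ∈ Finset.range n, (φ ^ (e * i)) (y * z)) / t := by
    rw [map_div₀, map_sum_orbit hy, map_sum_orbit (by rw [map_mul, hy, hza])]
  refine ⟨(∑ i ∈ Finset.range n, (φ ^ (e * i)) (y * z)) / t, ?_, fun m hm => ?_⟩
  · have : (∑ i ∈ Finset.range n, (φ ^ (e * i)) (y * z)) / t - z =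
        (∑ i ∈ Finset.range n, (φ ^ (e * i)) y * ((φ ^ (e * i)) z - z)) / t := by
      rw [eq_div_iff ht0, sub_mul, div_mul_cancel₀ _ ht0, ht, mul_comm z, Finset.sum_mul,
        ← Finset.sum_sub_distrib]
      exact Finset.sum_congr rfl fun i _ => by rw [map_mul]; ring
    rw [this, map_div₀, hy1, div_one]
    refine Valuation.map_sum_le _ fun i _ => ?_
    rw [map_mul, h.val_pow_map]
    exact (mul_le_of_le_one_left' hyle).trans (hmul i)
  · obtain ⟨k, rfl⟩ := hdvd m hm
    exact pow_mul_apply_eq_self hfix k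

end Char

end IsFrobeniusLift

/-! ### Newton polygons about a point -/

section ArgMax

variable {Γ : Type*} [LinearOrderedCommGroupWithZero Γ]

/-- The first index at which a weight function attains its maximum. -/
noncomputable def firstMax (w : ℕ → Γ) : ℕ := sInf {j | ∀ i, w i ≤ w j}

/-- The last index at which a weight function attains its maximum. -/
noncomputable def lastMax (w : ℕ → Γ) : ℕ := sSup {j | ∀ i, w i ≤ w j}

/-- A weight function of finite support that is not identically zero. -/
structure IsWeight (w : ℕ → Γ) : Prop where
  finite : ∃ N, ∀ i, N < i → w i = 0
  ne_zero : ∃ i, w i ≠ 0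

namespace IsWeight

variable {w : ℕ → Γ}

lemma nonempty (hw : IsWeight w) : {j | ∀ i, w i ≤ w j}.Nonempty := by
  obtain ⟨N, hN⟩ := hw.finite
  obtain ⟨j, -, hj⟩ := (Finset.range (N + 1)).exists_max_image w ⟨0, by simp⟩
  refine ⟨j, fun i => ?_⟩
  by_cases hi : i ≤ N
  · exact hj i (by simpa using Nat.lt_succ_of_le hi)
  · rw [hN i (not_le.1 hi)]; exact zero_le

lemma bddAbove (hw : IsWeight w) : BddAbove {j | ∀ i, w i ≤ w j} := by
  obtain ⟨N, hN⟩ := hw.finite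
  obtain ⟨i, hi⟩ := hw.ne_zero
  refine ⟨N, fun j hj => not_lt.1 fun hNj => hi ?_⟩
  have := hj i
  rw [hN j hNj] at this
  exact le_zero_iff.1 this

lemma le_firstMax (hw : IsWeight w) (i : ℕ) : w i ≤ w (firstMax w) := Nat.sInf_mem hw.nonempty i

lemma le_lastMax (hw : IsWeight w) (i : ℕ) : w i ≤ w (lastMax w) :=
  Nat.sSup_mem hw.nonempty hw.bddAbove i

lemma firstMax_eq_lastMax_val (hw : IsWeight w) : w (firstMax w) = w (lastMax w) :=
  le_antisymm (hw.le_lastMax _) (hw.le_firstMax _)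

lemma val_lastMax_pos (hw : IsWeight w) : 0 < w (lastMax w) := by
  obtain ⟨i, hi⟩ := hw.ne_zero
  exact (zero_lt_iff.2 hi).trans_le (hw.le_lastMax i)

lemma lt_of_lt_firstMax (hw : IsWeight w) {j : ℕ} (hj : j < firstMax w) :
    w j < w (firstMax w) := by
  refine lt_of_le_of_ne (hw.le_firstMax j) fun h => ?_
  exact absurd (Nat.sInf_le (s := {j | ∀ i, w i ≤ w j}) fun i => h ▸ hw.le_firstMax i)
    (not_le.2 hj)

lemma lt_of_lastMax_lt (hw : IsWeight w) {j : ℕ} (hj : lastMax w < j) :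
    w j < w (lastMax w) := by
  refine lt_of_le_of_ne (hw.le_lastMax j) fun h => ?_
  exact absurd (le_csSup (s := {j | ∀ i, w i ≤ w j}) hw.bddAbove fun i => h ▸ hw.le_lastMax i)
    (not_le.2 hj)

lemma lastMax_le_of_forall_lt (hw : IsWeight w) {m : ℕ} (h : ∀ j, m < j → w j < w m) :
    lastMax w ≤ m := not_lt.1 fun hlt => absurd (hw.le_lastMax m) (not_le.2 (h _ hlt))

lemma firstMax_le_lastMax (hw : IsWeight w) : firstMax w ≤ lastMax w :=
  Nat.sInf_le (Nat.sSup_mem hw.nonempty hw.bddAbove)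

end IsWeight

end ArgMax

section Newton

variable {E : Type*} [Field E] {Γ : Type*} [LinearOrderedCommGroupWithZero Γ] (v : Valuation E Γ)

/-- The values of the terms of the Taylor expansion of `f` at `z` on the sphere of radius `r`. -/
noncomputable def newtonWeight (f : E[X]) (z : E) (r : Γ) (j : ℕ) : Γ :=
  v ((taylor z f).coeff j) * r ^ j

variable {v} {f : E[X]} {z : E} {r : Γ}

lemma isWeight_newtonWeight (hf : f ≠ 0) (hr : r ≠ 0) : IsWeight (newtonWeight v f z r) where
  finite := ⟨f.natDegree, fun i hi => by
    rw [newtonWeight, coeff_eq_zero_of_natDegree_lt (by rwa [natDegree_taylor]), map_zero, zero_mul]⟩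
  ne_zero := ⟨f.natDegree, by
    have h : taylor z f ≠ 0 := by rwa [ne_eq, taylor_eq_zero]
    have h2 : (taylor z f).coeff f.natDegree ≠ 0 := by
      have := leadingCoeff_ne_zero.2 h
      rwa [leadingCoeff, natDegree_taylor] at this
    exact mul_ne_zero (by simpa using h2) (pow_ne_zero _ hr)⟩

/-- A zero at distance `r` from the center forces the maximal term to occur twice. -/
lemma firstMax_lt_lastMax (hf : f ≠ 0) {y : E} (hy : y ≠ 0) (hz : f.eval (z + y) = 0) :
    firstMax (newtonWeight v f z (v y)) < lastMax (newtonWeight v f z (v y)) := by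
  classical
  have hw := isWeight_newtonWeight (v := v) (z := z) hf (r := v y) (by simpa using hy)
  refine lt_of_le_of_ne hw.firstMax_le_lastMax fun heq => ?_
  set w := newtonWeight v f z (v y)
  set g := taylor z f with hg
  have hval : ∀ j, v (g.coeff j * y ^ j) = w j := fun j => by rw [map_mul, map_pow]; rfl
  have hsum : ∑ j ∈ Finset.range (g.natDegree + 1), g.coeff j * y ^ j = 0 := by
    rw [← eval_eq_sum_range, hg, taylor_eval, add_comm, hz]
  have hmem : lastMax w ∈ Finset.range (g.natDegree + 1) := by
    rw [Finset.mem_range, Nat.lt_succ_iff]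
    by_contra hlt
    have h0 := hval (lastMax w)
    rw [coeff_eq_zero_of_natDegree_lt (not_le.1 hlt), zero_mul, map_zero] at h0
    exact hw.val_lastMax_pos.ne h0
  rw [← Finset.add_sum_erase _ _ hmem] at hsum
  have hlt : v (∑ j ∈ (Finset.range (g.natDegree + 1)).erase (lastMax w), g.coeff j * y ^ j) <
      v (g.coeff (lastMax w) * y ^ lastMax w) := by
    rw [hval]
    refine Valuation.map_sum_lt _ hw.val_lastMax_pos.ne' fun j hj => ?_
    rw [hval]
    rcases lt_or_gt_of_ne (Finset.ne_of_mem_erase hj) with h | h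
    · rw [← heq] at h ⊢
      exact hw.lt_of_lt_firstMax h
    · exact hw.lt_of_lastMax_lt h
  have := Valuation.map_add_eq_of_lt_left v hlt
  rw [hsum, map_zero, hval] at this
  exact hw.val_lastMax_pos.ne this

/-- Convexity of the Newton polygon: shrinking the radius multiplies the j-th weight by (r'/r)^j,
which penalises larger indices. -/
lemma lastMax_le_firstMax_of_lt (hf : f ≠ 0) {r' : Γ} (hr' : r' ≠ 0) (h : r' < r) :
    lastMax (newtonWeight v f z r') ≤ firstMax (newtonWeight v f z r) := by
  have hr : r ≠ 0 := (zero_le.trans_lt h).ne'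
  have hw := isWeight_newtonWeight (v := v) (z := z) hf hr
  have hw' := isWeight_newtonWeight (v := v) (z := z) hf hr'
  refine hw'.lastMax_le_of_forall_lt fun j hj => ?_
  set l := firstMax (newtonWeight v f z r)
  have hconv : ∀ i, newtonWeight v f z r' i = newtonWeight v f z r i * (r' / r) ^ i := fun i => by
    rw [newtonWeight, newtonWeight, div_pow, mul_assoc, mul_div_cancel₀ _ (pow_ne_zero _ hr)]
  have hlpos : 0 < newtonWeight v f z r l := by
    rw [hw.firstMax_eq_lastMax_val]; exact hw.val_lastMax_pos
  have hq1 : r' / r < 1 := (div_lt_one₀ (zero_lt_iff.2 hr)).2 h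
  have hq0 : 0 < r' / r := zero_lt_iff.2 (div_ne_zero hr' hr)
  rw [hconv, hconv]
  calc _ ≤ newtonWeight v f z r l * (r' / r) ^ j := by gcongr; exact hw.le_firstMax j
    _ < _ := by
      have := pow_lt_pow_right_of_lt_one₀ hq0 hq1 hj
      exact mul_lt_mul_of_pos_left this hlpos

/-- On recentering within the ball, the old i-th term contributes only to new indices j ≤ i, with
weight at most its old one, since binomial coefficients have value at most 1. -/
lemma lastMax_taylor_le (hf : f ≠ 0) (hr : r ≠ 0) {y : E} (hy : v y ≤ r) :
    (∀ j, newtonWeight v f (y + z) r j ≤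
      newtonWeight v f z r (lastMax (newtonWeight v f z r))) ∧
    ∀ j, lastMax (newtonWeight v f z r) < j → newtonWeight v f (y + z) r j <
      newtonWeight v f z r (lastMax (newtonWeight v f z r)) := by
  have hw := isWeight_newtonWeight (v := v) (z := z) hf hr
  set w := newtonWeight v f z r
  have hcoef : ∀ j, (taylor (y + z) f).coeff j =
      ∑ i ∈ (taylor z f).support, (i.choose j : E) * (taylor z f).coeff i * y ^ (i - j) := by
    intro j
    rw [← taylor_taylor, taylor_coeff, hasseDeriv_apply, Polynomial.sum, eval_finsetSum]
    simp
  have hterm : ∀ i j, v ((i.choose j : E) * (taylor z f).coeff i * y ^ (i - j)) * r ^ j ≤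
      if j ≤ i then w i else 0 := by
    intro i j
    split_ifs with hij
    · rw [map_mul, map_mul, map_pow]
      have h1 : v (i.choose j : E) ≤ 1 := natCast_mem v.integer _
      calc _ ≤ 1 * v ((taylor z f).coeff i) * r ^ (i - j) * r ^ j := by gcongr
        _ = w i := by
          rw [one_mul, mul_assoc, ← pow_add, Nat.sub_add_cancel hij]; rfl
    · simp [Nat.choose_eq_zero_of_lt (not_le.1 hij)]
  have hrj : ∀ j, 0 < r ^ j := fun j => pow_pos (zero_lt_iff.2 hr) j
  refine ⟨fun j => ?_, fun j hj => ?_⟩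
  · rw [newtonWeight, hcoef, ← le_div_iff₀ (hrj j)]
    refine Valuation.map_sum_le _ fun i _ => ?_
    rw [le_div_iff₀ (hrj j)]
    refine (hterm i j).trans ?_
    split_ifs
    · exact hw.le_lastMax i
    · exact zero_le
  · rw [newtonWeight, hcoef, ← lt_div_iff₀ (hrj j)]
    refine Valuation.map_sum_lt _ (div_ne_zero hw.val_lastMax_pos.ne' (hrj j).ne') fun i _ => ?_
    rw [lt_div_iff₀ (hrj j)]
    refine (hterm i j).trans_lt ?_
    split_ifs with hij
    · exact hw.lt_of_lastMax_lt (hj.trans_le hij)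
    · exact hw.val_lastMax_pos

/-- The last maximal index depends only on the closed ball, not on its center. -/
lemma lastMax_eq_of_val_sub_le (hf : f ≠ 0) (hr : r ≠ 0) {z' : E} (h : v (z' - z) ≤ r) :
    lastMax (newtonWeight v f z' r) = lastMax (newtonWeight v f z r) := by
  have key : ∀ a b : E, v (a - b) ≤ r →
      newtonWeight v f a r (lastMax (newtonWeight v f a r)) ≤
        newtonWeight v f b r (lastMax (newtonWeight v f b r)) := fun a b hab => by
    have := (lastMax_taylor_le (z := b) hf hr hab).1 (lastMax (newtonWeight v f a r))
    rwa [sub_add_cancel] at this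
  have key2 : ∀ a b : E, v (a - b) ≤ r →
      lastMax (newtonWeight v f a r) ≤ lastMax (newtonWeight v f b r) := fun a b hab => by
    by_contra hlt
    have := (lastMax_taylor_le (z := b) hf hr hab).2 _ (not_le.1 hlt)
    rw [sub_add_cancel] at this
    exact absurd (key b a (by rwa [Valuation.map_sub_swap])) (not_le.2 this)
  exact le_antisymm (key2 _ _ h) (key2 _ _ (by rwa [Valuation.map_sub_swap]))

end Newton

/-! ### Relations over F_p between binomial coefficients of the exponents -/

section Relations

/-- The linear form `h ↦ ∑ n ∈ S, h n * n.choose j`. -/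
noncomputable def chooseForm (p : ℕ) (S : Finset ℕ) (j : ℕ) : Module.Dual (ZMod p) (S → ZMod p) :=
  ∑ n : S, ((n : ℕ).choose j : ZMod p) • LinearMap.proj n

/-- Coefficient vectors of polynomials over `ZMod p` with exponents in `S` that vanish at `1` to
order at least `M`. -/
noncomputable def relationSpace (p : ℕ) (S : Finset ℕ) (M : ℕ) :
    Submodule (ZMod p) (S → ZMod p) :=
  ⨅ j : Fin M, (chooseForm p S j).ker

lemma chooseForm_apply (p : ℕ) (S : Finset ℕ) (j : ℕ) (h : S → ZMod p) :
    chooseForm p S j h = ∑ n : S, ((n : ℕ).choose j : ZMod p) * h n := by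
  simp [chooseForm]

lemma mem_relationSpace {p : ℕ} {S : Finset ℕ} {M : ℕ} {h : S → ZMod p} :
    h ∈ relationSpace p S M ↔ ∀ j < M, chooseForm p S j h = 0 := by
  simp [relationSpace, Submodule.mem_iInf, LinearMap.mem_ker, Fin.forall_iff]

lemma relationSpace_anti (p : ℕ) (S : Finset ℕ) {M N : ℕ} (h : M ≤ N) :
    relationSpace p S N ≤ relationSpace p S M := fun _ hx =>
  mem_relationSpace.2 fun j hj => mem_relationSpace.1 hx j (hj.trans_le h)

variable {p : ℕ} [Fact p.Prime] {S : Finset ℕ}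

lemma finrank_relationSpace_anti {M N : ℕ} (h : M ≤ N) :
    Module.finrank (ZMod p) (relationSpace p S N) ≤ Module.finrank (ZMod p) (relationSpace p S M) :=
  Submodule.finrank_mono (relationSpace_anti p S h)

/-- The form of index 0 is the sum of the coordinates, hence nonzero. This is what turns k + 1 terms
into k coordinates. -/
lemma finrank_relationSpace_lt_card (hS : S.Nonempty) {M : ℕ} (hM : 0 < M) :
    Module.finrank (ZMod p) (relationSpace p S M) < S.card := by
  classical
  have h1 : Module.finrank (ZMod p) (S → ZMod p) = S.card := by simp
  rw [← h1]
  refine Submodule.finrank_lt fun htop => ?_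
  obtain ⟨n, hn⟩ := hS
  have h2 : (Pi.single ⟨n, hn⟩ 1 : S → ZMod p) ∈ relationSpace p S M := htop ▸ Submodule.mem_top
  have h3 := mem_relationSpace.1 h2 0 hM
  simp [chooseForm_apply, Pi.single_apply] at h3

variable {E : Type*} [Field E] [CharP E p] {Γ : Type*} [LinearOrderedCommGroupWithZero Γ]
  {v : Valuation E Γ}

/-- If the form of index `l` vanishes on all relations of order `l`, then the `l`-th divided
derivative at `1` of any polynomial is dominated by the previous ones. -/
lemma val_chooseSum_lt {l : ℕ} (hl : relationSpace p S l ≤ (chooseForm p S l).ker)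
    (b : S → E) {γ : Γ} (hγ : γ ≠ 0)
    (h : ∀ i < l, v (∑ n : S, ((n : ℕ).choose i : E) * b n) < γ) :
    v (∑ n : S, ((n : ℕ).choose l : E) * b n) < γ := by
  classical
  -- A form vanishing on the common kernel of the earlier forms is a combination of them; on basis
  -- vectors this expresses n.choose l modulo p through the n.choose i with i < l, uniformly in n ∈
  -- S.
  obtain ⟨a, ha⟩ := (Submodule.mem_span_range_iff_exists_fun (ZMod p)).1
    (mem_span_of_iInf_ker_le_ker (L := fun j : Fin l => chooseForm p S j) hl)
  have hn : ∀ n : S, ((n : ℕ).choose l : ZMod p) = ∑ i : Fin l, a i * ((n : ℕ).choose i : ZMod p) := by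
    intro n
    have := LinearMap.congr_fun ha (Pi.single n 1)
    simpa [chooseForm_apply, Pi.single_apply] using this.symm
  let c : ZMod p →+* E := ZMod.castHom dvd_rfl E
  have hn' : ∀ n : S, ((n : ℕ).choose l : E) = ∑ i : Fin l, c (a i) * ((n : ℕ).choose i : E) := by
    intro n
    have := congrArg c (hn n)
    simpa using this
  have hc : ∀ x, v (c x) ≤ 1 := fun x => by
    obtain ⟨m, rfl⟩ := ZMod.natCast_zmod_surjective x
    rw [map_natCast]
    exact natCast_mem v.integer m
  have : ∑ n : S, ((n : ℕ).choose l : E) * b n =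
      ∑ i : Fin l, c (a i) * ∑ n : S, ((n : ℕ).choose i : E) * b n := by
    simp only [hn', Finset.sum_mul, Finset.mul_sum]
    rw [Finset.sum_comm]
    simp only [mul_assoc]
  rw [this]
  refine Valuation.map_sum_lt _ hγ fun i _ => ?_
  rw [map_mul]
  exact (mul_le_of_le_one_left' (hc _)).trans_lt (h i i.2)

/-- The bridge between Newton polygons and relations: scaled Taylor coefficients are the forms
`chooseForm` evaluated on the vector of terms of f at z. -/
lemma taylor_coeff_mul_pow (f : E[X]) (z : E) (j : ℕ) :
    (taylor z f).coeff j * z ^ j =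
      ∑ n : f.support, ((n : ℕ).choose j : E) * (f.coeff n * z ^ (n : ℕ)) := by
  rw [taylor_coeff, hasseDeriv_apply, Polynomial.sum, eval_finsetSum, Finset.sum_mul,
    ← Finset.sum_coe_sort]
  refine Finset.sum_congr rfl fun n _ => ?_
  simp only [eval_monomial]
  by_cases h : j ≤ n
  · rw [mul_assoc, ← pow_add, Nat.sub_add_cancel h, mul_assoc]
  · simp [Nat.choose_eq_zero_of_lt (not_le.1 h)]

/-- If the dimension did not drop, the form at the first maximal index would depend on the earlier
ones, so its Taylor term at radius |z| would be dominated by theirs. But that term strictly exceeds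
them at radius r, and still does at the larger radius |z|. -/
lemma finrank_relationSpace_lastMax_lt {f : E[X]} (hf : f ≠ 0) {z : E} {r : Γ} (hr : r ≠ 0)
    (hrz : r < v z) (hlt : firstMax (newtonWeight v f z r) < lastMax (newtonWeight v f z r)) :
    Module.finrank (ZMod p) (relationSpace p f.support (lastMax (newtonWeight v f z r))) <
      Module.finrank (ZMod p) (relationSpace p f.support (firstMax (newtonWeight v f z r))) := by
  have hw := isWeight_newtonWeight (v := v) (z := z) hf hr
  have hz : v z ≠ 0 := (zero_le.trans_lt hrz).ne'
  set w := newtonWeight v f z r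
  have hle := relationSpace_anti p f.support hlt.le
  by_contra hcon
  have heq := Submodule.eq_of_le_of_finrank_le hle (not_lt.1 hcon)
  have hker : relationSpace p f.support (firstMax w) ≤ (chooseForm p f.support (firstMax w)).ker :=
    fun h hh => mem_relationSpace.1 (heq ▸ hh : h ∈ relationSpace p f.support (lastMax w)) _ hlt
  have hconv : ∀ i, v (∑ n : f.support, ((n : ℕ).choose i : E) * (f.coeff n * z ^ (n : ℕ))) =
      w i * (v z / r) ^ i := fun i => by
    rw [← taylor_coeff_mul_pow, map_mul, map_pow]
    simp only [w, newtonWeight]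
    rw [mul_assoc, ← mul_pow, mul_div_cancel₀ _ hr]
  have hpos : 0 < w (firstMax w) := by rw [hw.firstMax_eq_lastMax_val]; exact hw.val_lastMax_pos
  have h1 : 1 ≤ v z / r := (one_le_div₀ (zero_lt_iff.2 hr)).2 hrz.le
  have h0 : 0 < v z / r := zero_lt_one.trans_le h1
  refine lt_irrefl _ (val_chooseSum_lt (v := v) hker (fun n => f.coeff n * z ^ (n : ℕ)) ?_
    fun i hi => ?_)
  · rw [hconv]
    exact mul_ne_zero hpos.ne' (pow_ne_zero _ h0.ne')
  · rw [hconv, hconv]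
    calc w i * (v z / r) ^ i ≤ w i * (v z / r) ^ firstMax w := by
          gcongr
      _ < _ := mul_lt_mul_of_pos_right (hw.lt_of_lt_firstMax hi) (pow_pos h0 _)

/-- Reducing the terms of `f` at `z` modulo the maximal ideal yields a relation whose leading
exponent is the last one of maximal value. -/
lemma exists_relation {A : ValuationSubring E} {f : E[X]} (hf : f ≠ 0) {z : E} (hz : z ≠ 0) :
    ∃ h ∈ relationSpace p f.support (firstMax (newtonWeight A.valuation f z (A.valuation z))),
      ∀ n : f.support,
        ((n : ℕ) = lastMax (newtonWeight A.valuation f 0 (A.valuation z)) → h n ≠ 0) ∧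
        (lastMax (newtonWeight A.valuation f 0 (A.valuation z)) < n → h n = 0) := by
  have hvz : A.valuation z ≠ 0 := by simpa using hz
  have hw := isWeight_newtonWeight (v := A.valuation) (z := z) hf hvz
  have hw0 := isWeight_newtonWeight (v := A.valuation) (z := 0) hf hvz
  set w := newtonWeight A.valuation f z (A.valuation z)
  set N := lastMax (newtonWeight A.valuation f 0 (A.valuation z))
  set b : ℕ → E := fun n => f.coeff n * z ^ n with hb
  have hwb : ∀ n, newtonWeight A.valuation f 0 (A.valuation z) n = A.valuation (b n) := fun n => by
    simp [newtonWeight, hb]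
  have hbN : ∀ n, A.valuation (b n) ≤ A.valuation (b N) := fun n => by
    rw [← hwb, ← hwb]; exact hw0.le_lastMax n
  have hbN' : ∀ n, N < n → A.valuation (b n) < A.valuation (b N) := fun n hn => by
    rw [← hwb, ← hwb]; exact hw0.lt_of_lastMax_lt hn
  have hbN0 : A.valuation (b N) ≠ 0 := by rw [← hwb]; exact hw0.val_lastMax_pos.ne'
  have hval : ∀ n, A.valuation (b n / b N) ≤ 1 := fun n => by
    rw [map_div₀]; exact div_le_one_of_le₀ (hbN n) zero_le
  have hmem : ∀ n, b n / b N ∈ A := fun n => (A.valuation_le_one_iff _).1 (hval n)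
  have : CharP A p := RingHom.charP A.subtype Subtype.val_injective p
  have : CharP (IsLocalRing.ResidueField A) p := charP_of_injective_ringHom
      (f := (IsLocalRing.residue A).comp (ZMod.castHom dvd_rfl A)) (RingHom.injective _) p
  let _ : Algebra (ZMod p) (IsLocalRing.ResidueField A) := ZMod.algebra _ p
  -- The terms divided by the dominant one `b N` satisfy the relations over the residue field; an
  -- F_p-linear retraction with θ 1 = 1 brings them down to F_p and keeps the coordinate 1 at N.
  obtain ⟨θ, hθ⟩ := Module.Projective.exists_dual_eq_one (ZMod p)
    (x := (1 : IsLocalRing.ResidueField A)) one_ne_zero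
  refine ⟨fun n => θ (IsLocalRing.residue A ⟨b n / b N, hmem n⟩), ?_, fun n => ⟨?_, ?_⟩⟩
  · rw [mem_relationSpace]
    intro j hj
    have h1 : ∀ n : f.support, ((n : ℕ).choose j : ZMod p) *
        θ (IsLocalRing.residue A ⟨b n / b N, hmem n⟩) =
        θ (IsLocalRing.residue A (((n : ℕ).choose j : A) * ⟨b n / b N, hmem n⟩)) := fun n => by
      rw [map_mul, map_natCast, ← nsmul_eq_mul, ← nsmul_eq_mul, map_nsmul]
    rw [chooseForm_apply]
    simp only [h1]
    rw [← map_sum, ← map_sum]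
    have h2 : IsLocalRing.residue A
        (∑ n : f.support, ((n : ℕ).choose j : A) * ⟨b n / b N, hmem n⟩) = 0 := by
      rw [IsLocalRing.residue_eq_zero_iff, A.valuation_lt_one_iff]
      push_cast
      have h3 : ∑ n : f.support, ((n : ℕ).choose j : E) * (b n / b N) =
          (∑ n : f.support, ((n : ℕ).choose j : E) * b n) / b N := by
        rw [Finset.sum_div]
        simp only [mul_div_assoc]
      rw [h3, map_div₀, div_lt_one₀ (zero_lt_iff.2 hbN0)]
      have h4 : ∀ i, A.valuation (∑ n : f.support, ((n : ℕ).choose i : E) * b n) = w i := fun i => by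
        rw [← taylor_coeff_mul_pow, map_mul, map_pow]; rfl
      rw [h4]
      refine (hw.lt_of_lt_firstMax hj).trans_le ?_
      rw [← h4]
      refine Valuation.map_sum_le _ fun n _ => ?_
      rw [map_mul]
      exact (mul_le_of_le_one_left' (natCast_mem A.valuation.integer _)).trans (hbN n)
    rw [h2, map_zero]
  · intro hn
    have h1 : (⟨b n / b N, hmem n⟩ : A) = 1 := Subtype.ext (by
      rw [hn]
      exact div_self fun h => hbN0 (by rw [h, map_zero]))
    simp only [h1, map_one, hθ]
    exact one_ne_zero
  · intro hn
    have h1 : IsLocalRing.residue A ⟨b n / b N, hmem n⟩ = 0 := by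
      rw [IsLocalRing.residue_eq_zero_iff, A.valuation_lt_one_iff]
      change A.valuation (b n / b N) < 1
      rw [map_div₀, div_lt_one₀ (zero_lt_iff.2 hbN0)]
      exact hbN' n hn
    simp only [h1, map_zero]

omit [CharP E p] in
/-- Relations with distinct leading exponents are linearly independent. -/
lemma card_le_finrank_relationSpace {ι : Type*} (T : Finset ι) (N : ι → ℕ)
    (hN : ∀ i ∈ T, ∀ j ∈ T, N i = N j → i = j) {M : ℕ}
    (h : ∀ i ∈ T, ∃ x ∈ relationSpace p S M, N i ∈ S ∧
      ∀ n : S, ((n : ℕ) = N i → x n ≠ 0) ∧ (N i < n → x n = 0)) :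
    T.card ≤ Module.finrank (ZMod p) (relationSpace p S M) := by
  classical
  choose! x hx hNS hxN using h
  have hli : LinearIndependent (ZMod p) (fun i : T => (⟨x i, hx i i.2⟩ : relationSpace p S M)) := by
    rw [Fintype.linearIndependent_iff]
    intro g hg
    by_contra! hne
    obtain ⟨i₀, hi₀⟩ := hne
    obtain ⟨i, hi, hmax⟩ := (Finset.univ.filter fun i : T => g i ≠ 0).exists_max_image
      (fun i => N i) ⟨i₀, by simpa using hi₀⟩
    have hgi : g i ≠ 0 := by simpa using hi
    have h1 := congrFun (congrArg Subtype.val hg) ⟨N i, hNS i i.2⟩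
    simp only [Submodule.coe_sum, Submodule.coe_smul, Finset.sum_apply, Pi.smul_apply,
      smul_eq_mul, ZeroMemClass.coe_zero, Pi.zero_apply] at h1
    rw [Finset.sum_eq_single i] at h1
    · exact mul_ne_zero hgi ((hxN i i.2 ⟨N i, hNS i i.2⟩).1 rfl) h1
    · intro j _ hji
      by_cases hgj : g j = 0
      · rw [hgj, zero_mul]
      · have hle := hmax j (by simpa using hgj)
        have hlt : N j < N i := lt_of_le_of_ne hle fun h => hji (Subtype.ext (hN j j.2 i i.2 h))
        rw [(hxN j j.2 ⟨N i, hNS i i.2⟩).2 hlt, mul_zero]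
    · simp
  have := hli.fintype_card_le_finrank
  simpa using this

end Relations

/-! ### Numbering the branch radii by k indices -/

section Index

variable {E : Type*} [Field E]

/-- The radii at which the zeros of `f` branch off from the nonzero zero `z`, together with the
value of `z` itself. -/
def IsBranchRadius (A : ValuationSubring E) (f : E[X]) (z : E) (r : A.ValueGroup) : Prop :=
  r = A.valuation z ∨
    r < A.valuation z ∧ ∃ z', f.eval z' = 0 ∧ z' ≠ z ∧ r = A.valuation (z' - z)

variable {p : ℕ} [Fact p.Prime] [CharP E p] {A : ValuationSubring E} {f : E[X]}

-- At a zero the constant Taylor coefficient is 0, so index 0 carries no maximal weight.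
omit [Fact p.Prime] [CharP E p] in
lemma firstMax_pos_of_eval_eq_zero (hf : f ≠ 0) {z : E} (hz : f.eval z = 0) {r : A.ValueGroup}
    (hr : r ≠ 0) : 0 < firstMax (newtonWeight A.valuation f z r) := by
  have hw := isWeight_newtonWeight (v := A.valuation) (z := z) hf hr
  by_contra h
  have h1 : newtonWeight A.valuation f z r (firstMax (newtonWeight A.valuation f z r)) = 0 := by
    rw [Nat.eq_zero_of_not_pos h]
    simp [newtonWeight, taylor_coeff_zero, hz]
  rw [hw.firstMax_eq_lastMax_val] at h1
  exact hw.val_lastMax_pos.ne' h1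

/-- The nonzero values of the zeros of `f` can be numbered so that the number of a value is smaller
than the dimension of the relations attached to every zero of that value. -/
lemma exists_slope_numbering (p : ℕ) [Fact p.Prime] [CharP E p] (A : ValuationSubring E)
    (hf : f ≠ 0) : ∃ top : A.ValueGroup → ℕ,
      (∀ z, f.eval z = 0 → z ≠ 0 → top (A.valuation z) < Module.finrank (ZMod p)
        (relationSpace p f.support (firstMax (newtonWeight A.valuation f z (A.valuation z))))) ∧
      ∀ z z', f.eval z = 0 → z ≠ 0 → f.eval z' = 0 → z' ≠ 0 →
        top (A.valuation z) = top (A.valuation z') → A.valuation z = A.valuation z' := by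
  classical
  let Z : Finset E := f.roots.toFinset.erase 0
  have hZ : ∀ z, z ∈ Z ↔ f.eval z = 0 ∧ z ≠ 0 := fun z => by
    simp [Z, hf, and_comm]
  let M : E → ℕ := fun z => firstMax (newtonWeight A.valuation f z (A.valuation z))
  let m : A.ValueGroup → ℕ := fun s => (Z.filter fun z => A.valuation z = s).sup M
  let slopes : Finset A.ValueGroup := Z.image A.valuation
  -- Values are ranked by vanishing order `m`, ties broken by the value itself, and `top` counts the
  -- values ranked higher. All of these supply relations of order at least `m s`, and so does s
  -- itself, which is not counted: hence the strict bound.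
  let key : A.ValueGroup → ℕ ×ₗ A.ValueGroup := fun s => toLex (m s, s)
  have hkey : Function.Injective key := fun s s' h => congrArg Prod.snd h
  let top : A.ValueGroup → ℕ := fun s => (slopes.filter fun s' => key s < key s').card
  have hslope : ∀ s ∈ slopes, ∃ z ∈ Z, A.valuation z = s ∧ M z = m s := by
    intro s hs
    obtain ⟨z, hz, hzs⟩ := Finset.mem_image.1 hs
    obtain ⟨y, hy, hyM⟩ := Finset.exists_mem_eq_sup (Z.filter fun z => A.valuation z = s)
      ⟨z, by simp [hz, hzs]⟩ M
    exact ⟨y, (Finset.mem_filter.1 hy).1, (Finset.mem_filter.1 hy).2, hyM.symm⟩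
  let N : A.ValueGroup → ℕ := fun s => lastMax (newtonWeight A.valuation f 0 s)
  have hslope0 : ∀ s ∈ slopes, s ≠ 0 := by
    intro s hs
    obtain ⟨z, hz, rfl, -⟩ := hslope s hs
    simpa using ((hZ z).1 hz).2
  have hNlt : ∀ s ∈ slopes, ∀ s' ∈ slopes, s < s' → N s < N s' := by
    intro s hs s' hs' hlt
    obtain ⟨z, hz, rfl, -⟩ := hslope s' hs'
    obtain ⟨hz, hz0⟩ := (hZ z).1 hz
    exact (lastMax_le_firstMax_of_lt hf (hslope0 s hs) hlt).trans_lt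
      (firstMax_lt_lastMax hf hz0 (by rwa [zero_add]))
  have hcard : ∀ s ∈ slopes, (slopes.filter fun s' => m s ≤ m s').card ≤
      Module.finrank (ZMod p) (relationSpace p f.support (m s)) := by
    intro s hs
    refine card_le_finrank_relationSpace _ N ?_ ?_
    · intro i hi j hj hij
      have hi := (Finset.mem_filter.1 hi).1
      have hj := (Finset.mem_filter.1 hj).1
      by_contra hne
      rcases lt_or_gt_of_ne hne with h | h
      · exact (hNlt i hi j hj h).ne hij
      · exact (hNlt j hj i hi h).ne' hij
    · intro i hi
      obtain ⟨his, hile⟩ := Finset.mem_filter.1 hi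
      obtain ⟨z, hz, rfl, hzM⟩ := hslope i his
      obtain ⟨hz, hz0⟩ := (hZ z).1 hz
      obtain ⟨x, hx, hxN⟩ := exists_relation (p := p) (A := A) hf hz0
      refine ⟨x, relationSpace_anti p f.support (hile.trans hzM.ge) hx, ?_, hxN⟩
      rw [mem_support_iff]
      intro h0
      have := (isWeight_newtonWeight (v := A.valuation) (z := 0) hf
        (hslope0 _ his)).val_lastMax_pos
      change 0 < newtonWeight _ _ _ _ (N (A.valuation z)) at this
      simp [newtonWeight, h0] at this
  refine ⟨top, fun z hz hz0 => ?_, fun z z' hz hz0 hz' hz0' htop => ?_⟩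
  · have hzZ := (hZ z).2 ⟨hz, hz0⟩
    have hs : A.valuation z ∈ slopes := Finset.mem_image_of_mem _ hzZ
    have hle : M z ≤ m (A.valuation z) :=
      Finset.le_sup (f := M) (Finset.mem_filter.2 ⟨hzZ, rfl⟩)
    refine lt_of_lt_of_le ?_ ((hcard _ hs).trans (finrank_relationSpace_anti hle))
    refine Finset.card_lt_card (Finset.ssubset_iff_of_subset ?_ |>.2 ⟨A.valuation z, ?_, ?_⟩)
    · intro s' hs'
      obtain ⟨h1, h2⟩ := Finset.mem_filter.1 hs'
      refine Finset.mem_filter.2 ⟨h1, ?_⟩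
      rcases Prod.Lex.lt_iff.1 h2 with h | h
      · exact h.le
      · exact h.1.le
    · simp [hs]
    · simp
  · have hs : A.valuation z ∈ slopes := Finset.mem_image_of_mem _ ((hZ z).2 ⟨hz, hz0⟩)
    have hs' : A.valuation z' ∈ slopes := Finset.mem_image_of_mem _ ((hZ z').2 ⟨hz', hz0'⟩)
    have key_lt : ∀ a ∈ slopes, ∀ b ∈ slopes, key a < key b → top b < top a := by
      intro a _ b hb hab
      refine Finset.card_lt_card (Finset.ssubset_iff_of_subset ?_ |>.2 ⟨b, ?_, ?_⟩)
      · intro c hc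
        obtain ⟨h1, h2⟩ := Finset.mem_filter.1 hc
        exact Finset.mem_filter.2 ⟨h1, hab.trans h2⟩
      · simp [hb, hab]
      · simp
    by_contra hne
    rcases lt_or_gt_of_ne (hkey.ne hne) with h | h
    · exact (key_lt _ hs _ hs' h).ne' htop
    · exact (key_lt _ hs' _ hs h).ne htop

/-- Numbering of the branch radii of the nonzero zeros of a polynomial with `k + 1` terms by
natural numbers below `k`. -/
lemma exists_branch_numbering (p : ℕ) [Fact p.Prime] [CharP E p] (A : ValuationSubring E) {k : ℕ}
    (hk : f.support.card = k + 1) : ∃ I : E → A.ValueGroup → ℕ,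
      (∀ z r, f.eval z = 0 → z ≠ 0 → IsBranchRadius A f z r → I z r < k) ∧
      (∀ z r r', f.eval z = 0 → z ≠ 0 → IsBranchRadius A f z r → IsBranchRadius A f z r' →
        I z r = I z r' → r = r') ∧
      (∀ z z' r, A.valuation z = A.valuation z' → A.valuation (z' - z) ≤ r → r ≠ 0 →
        I z r = I z' r) ∧
      (∀ z z', f.eval z = 0 → z ≠ 0 → f.eval z' = 0 → z' ≠ 0 →
        I z (A.valuation z) = I z' (A.valuation z') → A.valuation z = A.valuation z') ∧
      ∀ z r, f.eval z = 0 → z ≠ 0 → IsBranchRadius A f z r → I z (A.valuation z) ≤ I z r := by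
  classical
  have hf : f ≠ 0 := by rintro rfl; simp at hk
  have hne : f.support.Nonempty := Finset.card_pos.1 (by lia)
  obtain ⟨top, htop, htopinj⟩ := exists_slope_numbering p A hf
  let δ : ℕ → ℕ := fun M => Module.finrank (ZMod p) (relationSpace p f.support M)
  let L : E → A.ValueGroup → ℕ := fun z r => lastMax (newtonWeight A.valuation f z r)
  let l : E → A.ValueGroup → ℕ := fun z r => firstMax (newtonWeight A.valuation f z r)
  have hδ : ∀ {M N}, M ≤ N → δ N ≤ δ M := fun h => finrank_relationSpace_anti h
  have hδk : ∀ z r, f.eval z = 0 → r ≠ 0 → δ (l z r) ≤ k := fun z r hz hr => by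
    have := finrank_relationSpace_lt_card (p := p) hne (firstMax_pos_of_eval_eq_zero hf hz hr)
    rw [hk] at this
    exact Nat.lt_succ_iff.1 this
  have hval : ∀ z : E, z ≠ 0 → A.valuation z ≠ 0 := fun z hz => by simpa using hz
  have hstep : ∀ z r, f.eval z = 0 → z ≠ 0 → IsBranchRadius A f z r → r ≠ A.valuation z →
      r ≠ 0 ∧ r < A.valuation z ∧ δ (L z r) < δ (l z r) := by
    intro z r hz hz0 hr hne
    obtain ⟨hlt, z', hz', hzz', rfl⟩ := hr.resolve_left hne
    have h0 := hval _ (sub_ne_zero.2 hzz')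
    exact ⟨h0, hlt, finrank_relationSpace_lastMax_lt hf h0 hlt
      (firstMax_lt_lastMax hf (sub_ne_zero.2 hzz') (by rwa [add_sub_cancel]))⟩
  have htopidx : ∀ z r, f.eval z = 0 → z ≠ 0 → IsBranchRadius A f z r → r ≠ A.valuation z →
      top (A.valuation z) < δ (L z r) := by
    intro z r hz hz0 hr hne
    obtain ⟨h0, hlt, -⟩ := hstep z r hz hz0 hr hne
    exact (htop z hz hz0).trans_le (hδ (lastMax_le_firstMax_of_lt hf h0 hlt))
  have hmono : ∀ z r r', f.eval z = 0 → z ≠ 0 → IsBranchRadius A f z r → r ≠ A.valuation z →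
      IsBranchRadius A f z r' → r' ≠ A.valuation z → r' < r → δ (L z r) < δ (L z r') := by
    intro z r r' hz hz0 hr hne hr' hne' hlt
    exact (hstep z r hz hz0 hr hne).2.2.trans_le
      (hδ (lastMax_le_firstMax_of_lt hf (hstep z r' hz hz0 hr' hne').1 hlt))
  -- Radii below |z| are numbered by the dimension at the last maximal index, which depends only on
  -- the ball and strictly increases as r shrinks. The number of |z| lies below all of these.
  refine ⟨fun z r => if r = A.valuation z then top (A.valuation z) else δ (L z r),
    fun z r hz hz0 hr => ?_, fun z r r' hz hz0 hr hr' heq => ?_, fun z z' r hv hle hr => ?_,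
    fun z z' hz hz0 hz' hz0' heq => ?_, fun z r hz hz0 hr => ?_⟩
  · dsimp only
    split_ifs with h
    · exact (htop z hz hz0).trans_le (hδk z _ hz (hval z hz0))
    · obtain ⟨h0, -, hlt⟩ := hstep z r hz hz0 hr h
      exact hlt.trans_le (hδk z r hz h0)
  · dsimp only at heq
    split_ifs at heq with h h' h'
    · rw [h, h']
    · exact absurd heq (htopidx z r' hz hz0 hr' h').ne
    · exact absurd heq (htopidx z r hz hz0 hr h).ne'
    · by_contra hne
      rcases lt_or_gt_of_ne hne with hlt | hlt
      · exact (hmono z r' r hz hz0 hr' h' hr h hlt).ne' heq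
      · exact (hmono z r r' hz hz0 hr h hr' h' hlt).ne heq
  · dsimp only [L]
    rw [hv, lastMax_eq_of_val_sub_le hf hr hle]
  · simp only [if_true] at heq
    exact htopinj z z' hz hz0 hz' hz0' heq
  · dsimp only
    rw [if_pos rfl]
    split_ifs with h
    · exact le_rfl
    · exact (htopidx z r hz hz0 hr h).le

end Index

/-! ### Encoding zeros by tuples over the residue field -/

/-- Every closed ball has a center fixed by all powers of the Frobenius that preserve the ball. -/
lemma IsFrobeniusLift.exists_ball_center {E : Type*} [Field E] [IsAlgClosed E] {p s : ℕ}
    [Fact p.Prime] [CharP E p] {A : ValuationSubring E} {φ : E →+* E}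
    (h : IsFrobeniusLift A φ (p ^ s)) (hs : s ≠ 0) :
    ∃ c : Set E → E, ∀ z r, A.valuation (c {x | A.valuation (x - z) ≤ r} - z) ≤ r ∧
      ∀ e, A.valuation ((φ ^ e) z - z) ≤ r →
        (φ ^ e) (c {x | A.valuation (x - z) ≤ r}) = c {x | A.valuation (x - z) ≤ r} := by
  have hC : ∀ B : Set E, ∃ c, ∀ z r, B = {x | A.valuation (x - z) ≤ r} → c ∈ B ∧
      ∀ e, (φ ^ e) z ∈ B → (φ ^ e) c = c := fun B => by
    by_cases hB : ∃ z r, B = {x | A.valuation (x - z) ≤ r}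
    · obtain ⟨z, r, rfl⟩ := hB
      obtain ⟨c, hc, hcφ⟩ := h.exists_center hs z r
      refine ⟨c, fun z' r' hB' => ⟨hc, fun e he => hcφ e ?_⟩⟩
      have hz' : z' ∈ {x | A.valuation (x - z) ≤ r} := by
        rw [hB']
        change A.valuation (z' - z') ≤ r'
        simp
      have h1 : A.valuation ((φ ^ e) z - (φ ^ e) z') ≤ r := by
        rw [← map_sub, h.val_pow_map, Valuation.map_sub_swap]
        exact hz'
      rw [← sub_add_sub_cancel _ ((φ ^ e) z')]
      exact Valuation.map_add_le _ h1 he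
    · exact ⟨0, fun z r hzr => absurd ⟨z, r, hzr⟩ hB⟩
  choose c hc using hC
  exact ⟨c, fun z r => ⟨(hc _ z r rfl).1, fun e he => (hc _ z r rfl).2 e he⟩⟩

open Classical in
/-- The residue map of a valuation subring, extended by zero. -/
noncomputable def residueOrZero {E : Type*} [Field E] (A : ValuationSubring E) (x : E) :
    IsLocalRing.ResidueField A :=
  if hx : x ∈ A then IsLocalRing.residue A ⟨x, hx⟩ else 0

lemma residueOrZero_eq_iff {E : Type*} [Field E] {A : ValuationSubring E} {x y : E}
    (hx : A.valuation x ≤ 1) (hy : A.valuation y ≤ 1) :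
    residueOrZero A x = residueOrZero A y ↔ A.valuation (x - y) < 1 := by
  rw [A.valuation_le_one_iff] at hx hy
  rw [residueOrZero, residueOrZero, dif_pos hx, dif_pos hy]
  exact Ideal.Quotient.eq.trans (A.valuation_lt_one_iff _)

lemma residueOrZero_pow {E : Type*} [Field E] {A : ValuationSubring E} {x : E}
    (hx : A.valuation x ≤ 1) (n : ℕ) : residueOrZero A (x ^ n) = residueOrZero A x ^ n := by
  rw [A.valuation_le_one_iff] at hx
  rw [residueOrZero, residueOrZero, dif_pos hx, dif_pos (pow_mem hx n), ← map_pow]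
  rfl

lemma residueOrZero_zero {E : Type*} [Field E] (A : ValuationSubring E) :
    residueOrZero A 0 = 0 := by
  rw [residueOrZero, dif_pos A.zero_mem]
  exact map_zero _

/-- Encoding of the zeros of a polynomial with `k + 1` terms by `k`-tuples over the residue field,
compatible with the Frobenius. -/
theorem exists_address {E : Type*} [Field E] [IsAlgClosed E] {p s : ℕ} [Fact p.Prime] [CharP E p]
    {A : ValuationSubring E} {φ : E →+* E} (h : IsFrobeniusLift A φ (p ^ s)) (hs : s ≠ 0)
    {f : E[X]} {k : ℕ} (hk : f.support.card = k + 1) :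
    ∃ addr : E → Fin k → IsLocalRing.ResidueField A,
      Set.InjOn addr {z | f.eval z = 0} ∧
      ∀ z, f.eval z = 0 → ∀ e, (φ ^ e) z = z → ∀ i, addr z i ^ (p ^ s) ^ e = addr z i := by
  classical
  obtain ⟨I, hIk, hIinj, hIball, hItop, hIle⟩ := exists_branch_numbering (f := f) p A hk
  have hT : ∀ r : A.ValueGroup, r ≠ 0 → ∃ t, A.valuation t = r ∧ φ t = t := fun r hr => by
    obtain ⟨x, rfl⟩ := A.valuation_surjective r
    exact h.exists_fixed_val_eq hs (by simpa using hr)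
  choose! T hTval hTφ using hT
  obtain ⟨c, hc⟩ := h.exists_ball_center hs
  -- Center 0 at radius |z| makes the leading digit nonzero. Below |z| the center is a function of
  -- the ball alone, hence shared by all zeros in it.
  let ctr : E → A.ValueGroup → E := fun z r =>
    if r = A.valuation z then 0 else c {x | A.valuation (x - z) ≤ r}
  have hctr : ∀ z r, A.valuation (z - ctr z r) ≤ r := fun z r => by
    dsimp only [ctr]
    split_ifs with hr
    · rw [sub_zero, hr]
    · rw [Valuation.map_sub_swap]
      exact (hc z r).1
  have hctrφ : ∀ z r e, (φ ^ e) z = z → (φ ^ e) (ctr z r) = ctr z r := fun z r e he => by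
    dsimp only [ctr]
    split_ifs with hr
    · simp
    · exact (hc z r).2 e (by simp [he])
  have hctr_eq : ∀ z z' r, A.valuation z = A.valuation z' → A.valuation (z' - z) ≤ r →
      ctr z r = ctr z' r := fun z z' r hv hle => by
    dsimp only [ctr]
    have : {x | A.valuation (x - z) ≤ r} = {x | A.valuation (x - z') ≤ r} := by
      ext x
      simp only [Set.mem_ofPred_eq]
      constructor <;> intro hx
      · rw [← sub_add_sub_cancel x z z']
        exact Valuation.map_add_le _ hx (by rwa [Valuation.map_sub_swap])
      · rw [← sub_add_sub_cancel x z' z]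
        exact Valuation.map_add_le _ hx hle
    rw [hv, this]
  have hbr0 : ∀ z r, z ≠ 0 → IsBranchRadius A f z r → r ≠ 0 := by
    rintro z r hz0 (rfl | ⟨-, z', -, hne, rfl⟩)
    · simpa using hz0
    · simpa [sub_eq_zero] using hne
  let dig : E → A.ValueGroup → E := fun z r => (z - ctr z r) / T r
  have hdig : ∀ z r, r ≠ 0 → A.valuation (dig z r) ≤ 1 := fun z r hr => by
    rw [map_div₀, hTval r hr]
    exact div_le_one_of_le₀ (hctr z r) zero_le
  -- Coordinates that number no branch radius of z are 0, as are all coordinates of the zero z = 0.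
  let addr : E → Fin k → IsLocalRing.ResidueField A := fun z i =>
    if hz : z ≠ 0 ∧ ∃ r, IsBranchRadius A f z r ∧ I z r = i then
      residueOrZero A (dig z hz.2.choose) else 0
  have haddr : ∀ z r, f.eval z = 0 → z ≠ 0 → IsBranchRadius A f z r → ∀ i : Fin k, I z r = i →
      addr z i = residueOrZero A (dig z r) := by
    intro z r hz hz0 hr i hi
    have hex : z ≠ 0 ∧ ∃ r, IsBranchRadius A f z r ∧ I z r = i := ⟨hz0, r, hr, hi⟩
    dsimp only [addr]
    rw [dif_pos hex]
    have := hex.2.choose_spec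
    rw [hIinj z _ r hz hz0 this.1 hr (this.2.trans hi.symm)]
  have htopne : ∀ z, f.eval z = 0 → z ≠ 0 → ∀ i : Fin k, I z (A.valuation z) = i →
      addr z i ≠ 0 := by
    intro z hz hz0 i hi h0
    have hv : A.valuation z ≠ 0 := by simpa using hz0
    rw [haddr z _ hz hz0 (Or.inl rfl) i hi, ← residueOrZero_zero A,
      residueOrZero_eq_iff (hdig z _ hv) (by simp), sub_zero, map_div₀, hTval _ hv] at h0
    simp [ctr, hv] at h0
  have hbelow : ∀ z, f.eval z = 0 → z ≠ 0 → ∀ i : Fin k, (i : ℕ) < I z (A.valuation z) →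
      addr z i = 0 := by
    intro z hz hz0 i hi
    dsimp only [addr]
    rw [dif_neg]
    rintro ⟨-, r, hr, hri⟩
    exact absurd (hIle z r hz hz0 hr) (by lia)
  refine ⟨addr, fun z hz z' hz' heq => ?_, fun z hz e he i => ?_⟩
  · have hz : f.eval z = 0 := hz
    have hz' : f.eval z' = 0 := hz'
    have hzero : addr 0 = 0 := by
      ext i
      simp [addr]
    have hne : ∀ y, f.eval y = 0 → y ≠ 0 → addr y ≠ 0 := fun y hy hy0 h0 =>
      htopne y hy hy0 ⟨_, hIk y _ hy hy0 (Or.inl rfl)⟩ rfl (congrFun h0 _)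
    by_cases hz0 : z = 0
    · by_contra hzz
      exact hne z' hz' (fun h => hzz (hz0.trans h.symm)) (heq ▸ hz0 ▸ hzero)
    by_cases hz0' : z' = 0
    · exact absurd (heq.trans (hz0' ▸ hzero)) (hne z hz hz0)
    -- The number of |a| is the position of the first nonzero coordinate, so the address determines
    -- |a|.
    have hlt : ∀ a b, f.eval a = 0 → a ≠ 0 → f.eval b = 0 → b ≠ 0 → addr a = addr b →
        ¬ I a (A.valuation a) < I b (A.valuation b) := by
      intro a b ha ha0 hb hb0 hab hlt
      let i : Fin k := ⟨_, hIk a _ ha ha0 (Or.inl rfl)⟩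
      exact htopne a ha ha0 i rfl ((congrFun hab i).trans (hbelow b hb hb0 i hlt))
    have hv : A.valuation z = A.valuation z' :=
      hItop z z' hz hz0 hz' hz0' (le_antisymm (not_lt.1 (hlt z' z hz' hz0' hz hz0 heq.symm))
        (not_lt.1 (hlt z z' hz hz0 hz' hz0' heq)))
    by_contra hzz
    set r := A.valuation (z' - z) with hr
    have hr0 : r ≠ 0 := by simpa [hr, sub_eq_zero] using fun h => hzz h.symm
    have hrle : r ≤ A.valuation z := Valuation.map_sub_le _ hv.ge le_rfl
    have hbz : IsBranchRadius A f z r := by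
      rcases hrle.eq_or_lt with h1 | h1
      · exact Or.inl h1
      · exact Or.inr ⟨h1, z', hz', Ne.symm hzz, rfl⟩
    have hbz' : IsBranchRadius A f z' r := by
      rcases hrle.eq_or_lt with h1 | h1
      · exact Or.inl (h1.trans hv)
      · exact Or.inr ⟨hv ▸ h1, z, hz, hzz, Valuation.map_sub_swap _ _ _⟩
    have h1 := congrFun heq ⟨_, hIk z r hz hz0 hbz⟩
    rw [haddr z r hz hz0 hbz _ rfl, haddr z' r hz' hz0' hbz' _ (hIball z z' r hv le_rfl hr0).symm,
      residueOrZero_eq_iff (hdig z r hr0) (hdig z' r hr0)] at h1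
    -- At the separating radius both zeros use the same center and scale, so their digits differ by
    -- an element of value 1.
    have h2 : dig z r - dig z' r = (z - z') / T r := by
      dsimp only [dig]
      rw [hctr_eq z z' r hv le_rfl]
      ring
    rw [h2, map_div₀, hTval r hr0, Valuation.map_sub_swap, ← hr, div_self hr0] at h1
    exact lt_irrefl _ h1
  · dsimp only [addr]
    split_ifs with hex
    · set r := hex.2.choose
      have hr0 : r ≠ 0 := hbr0 z r hex.1 hex.2.choose_spec.1
      have hfix : (φ ^ e) (dig z r) = dig z r := by
        have hTe : (φ ^ e) (T r) = T r := by
          have := IsFrobeniusLift.pow_mul_apply_eq_self (φ := φ) (e := 1) (x := T r)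
            (by simpa using hTφ r hr0) e
          rwa [one_mul] at this
        rw [map_div₀, map_sub, he, hctrφ z r e he, hTe]
      have hd := hdig z r hr0
      rw [← residueOrZero_pow hd, eq_comm, residueOrZero_eq_iff hd (by
        rw [map_pow]; exact pow_le_one₀ zero_le hd)]
      have := h.val_pow_map_sub_lt e ((A.valuation_le_one_iff _).1 hd)
      rwa [hfix] at this
    · exact zero_pow (pow_pos (pow_pos (Fact.out : p.Prime).pos s) e).ne'

/-! ### Counting tuples of bounded Frobenius period -/

/-- If `F ^[j]` has `Q ^ j` fixed points for all `j ≥ 1`, then the number of points of period at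
most `d` is given by Möbius inversion. -/
lemma card_exists_isPeriodicPt {X : Type*} (F : X → X) (Q : ℕ)
    (hfin : ∀ j, 0 < j → {x | F.IsPeriodicPt j x}.Finite)
    (hcard : ∀ j, 0 < j → {x | F.IsPeriodicPt j x}.ncard = Q ^ j) (d : ℕ) :
    {x | ∃ j ∈ Finset.Icc 1 d, F.IsPeriodicPt j x}.Finite ∧
      ({x | ∃ j ∈ Finset.Icc 1 d, F.IsPeriodicPt j x}.ncard : ℤ) =
        ∑ j ∈ Finset.Icc 1 d, ∑ i ∈ j.divisors, ArithmeticFunction.moebius (j / i) * (Q : ℤ) ^ i := by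
  classical
  have hexact : ∀ j, 0 < j → {x | F.minimalPeriod x = j} ⊆ {x | F.IsPeriodicPt j x} :=
    fun j _ x hx => Function.isPeriodicPt_iff_minimalPeriod_dvd.2 (dvd_of_eq hx)
  -- The fixed points of `F^[j]` are partitioned by minimal period, a divisor of j; Möbius inversion
  -- isolates each exact period.
  have hsum : ∀ j > 0, ∑ i ∈ j.divisors, ({x | F.minimalPeriod x = i}.ncard : ℤ) = (Q : ℤ) ^ j := by
    intro j hj
    rw [← Nat.cast_pow, ← hcard j hj, Set.ncard_eq_toFinset_card _ (hfin j hj),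
      Finset.card_eq_sum_card_fiberwise (f := F.minimalPeriod) (t := j.divisors)]
    · push_cast
      refine Finset.sum_congr rfl fun i hi => ?_
      rw [← Set.ncard_coe_finset]
      congr 2
      ext x
      simp only [Set.mem_ofPred_eq, Finset.coe_filter, Set.Finite.mem_toFinset]
      refine ⟨fun h => ⟨?_, h⟩, fun h => h.2⟩
      exact Function.isPeriodicPt_iff_minimalPeriod_dvd.2 (h ▸ Nat.dvd_of_mem_divisors hi)
    · intro x hx
      have hx : F.IsPeriodicPt j x := by simpa using hx
      simpa [hj.ne'] using hx.minimalPeriod_dvd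
  have hinv := ArithmeticFunction.sum_eq_iff_sum_mul_moebius_eq.1 hsum
  have hU : {x | ∃ j ∈ Finset.Icc 1 d, F.IsPeriodicPt j x}.Finite := by
    have : {x | ∃ j ∈ Finset.Icc 1 d, F.IsPeriodicPt j x} =
        ⋃ j ∈ Finset.Icc 1 d, {x | F.IsPeriodicPt j x} := by
      ext x
      simp
    rw [this]
    exact Set.Finite.biUnion (Finset.finite_toSet _) fun j hj => hfin j (Finset.mem_Icc.1 hj).1
  refine ⟨hU, ?_⟩
  rw [Set.ncard_eq_toFinset_card _ hU,
    Finset.card_eq_sum_card_fiberwise (f := F.minimalPeriod) (t := Finset.Icc 1 d)]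
  · push_cast
    refine Finset.sum_congr rfl fun j hj => ?_
    have hj0 := (Finset.mem_Icc.1 hj).1
    have h1 := hinv j hj0
    simp only [Int.cast_id] at h1
    rw [Nat.sum_divisorsAntidiagonal' (fun a b => (ArithmeticFunction.moebius a : ℤ) * (Q : ℤ) ^ b)]
      at h1
    rw [h1, ← Set.ncard_coe_finset]
    congr 2
    ext x
    simp only [Set.mem_ofPred_eq, Finset.coe_filter, Set.Finite.mem_toFinset]
    refine ⟨fun h => h.2, fun h => ⟨⟨j, hj, hexact j hj0 h⟩, h⟩⟩
  · intro x hx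
    obtain ⟨j, hj, hx⟩ : ∃ j ∈ Finset.Icc 1 d, F.IsPeriodicPt j x := by simpa using hx
    obtain ⟨h1, h2⟩ := Finset.mem_Icc.1 hj
    exact Finset.mem_coe.2 (Finset.mem_Icc.2 ⟨hx.minimalPeriod_pos h1, (hx.minimalPeriod_le h1).trans h2⟩)

/-- The residue field of a valuation ring of an algebraically closed field of characteristic `p`
contains `p ^ n` roots of `x ^ p ^ n = x`. -/
lemma card_residueField_pow_eq_self {E : Type*} [Field E] [IsAlgClosed E] {p : ℕ} [Fact p.Prime]
    [CharP E p] (A : ValuationSubring E) {n : ℕ} (hn : n ≠ 0) :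
    Nat.card {x : IsLocalRing.ResidueField A // x ^ p ^ n = x} = p ^ n := by
  classical
  have hp := Nat.one_lt_pow hn (Fact.out : p.Prime).one_lt
  let κ := IsLocalRing.ResidueField A
  have hX : (X ^ p ^ n - X : κ[X]) ≠ 0 := FiniteField.X_pow_card_sub_X_ne_zero κ hp
  have hroot : ∀ x : κ, x ∈ (X ^ p ^ n - X : κ[X]).roots.toFinset ↔ x ^ p ^ n = x := fun x => by
    rw [Multiset.mem_toFinset, mem_roots hX]
    simp [sub_eq_zero]
  have hcard : Nat.card {x : κ // x ^ p ^ n = x} =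
      (X ^ p ^ n - X : κ[X]).roots.toFinset.card := Nat.subtype_card _ hroot
  change Nat.card {x : κ // x ^ p ^ n = x} = p ^ n
  rw [hcard]
  refine le_antisymm ?_ ?_
  · refine (Multiset.toFinset_card_le _).trans ((card_roots' _).trans_eq ?_)
    exact FiniteField.X_pow_card_sub_X_natDegree_eq κ hp
  · obtain ⟨T, hT, hTmem⟩ := IsFrobeniusLift.card_pow_eq_self (E := E) (p := p) hn
    have hle : ∀ x ∈ T, A.valuation x ≤ 1 := fun x hx =>
      IsFrobeniusLift.val_le_one_of_pow_eq A hp ((hTmem x).1 hx)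
    refine hT.symm.trans_le (Finset.card_le_card_of_injOn (residueOrZero A) (fun x hx => ?_) fun x hx y hy hxy => ?_)
    · rw [Finset.mem_coe, hroot, ← residueOrZero_pow (hle x hx), (hTmem x).1 hx]
    · by_contra hne
      exact ((residueOrZero_eq_iff (hle x hx) (hle y hy)).1 hxy).ne
        (IsFrobeniusLift.val_sub_eq_one_of_pow_eq A hn ((hTmem x).1 hx) ((hTmem y).1 hy) hne)

/-- Tuples over the residue field of Frobenius period at most `d`. -/
lemma card_exists_frobenius_fixed {E : Type*} [Field E] [IsAlgClosed E] {p s : ℕ} [Fact p.Prime]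
    [CharP E p] (A : ValuationSubring E) (hs : s ≠ 0) (k d : ℕ) :
    {x : Fin k → IsLocalRing.ResidueField A |
        ∃ j ∈ Finset.Icc 1 d, ∀ i, x i ^ (p ^ s) ^ j = x i}.Finite ∧
      ({x : Fin k → IsLocalRing.ResidueField A |
        ∃ j ∈ Finset.Icc 1 d, ∀ i, x i ^ (p ^ s) ^ j = x i}.ncard : ℤ) =
        ∑ j ∈ Finset.Icc 1 d, ∑ i ∈ j.divisors,
          ArithmeticFunction.moebius (j / i) * ((p ^ s : ℕ) : ℤ) ^ (i * k) := by
  let κ := IsLocalRing.ResidueField A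
  let F : (Fin k → κ) → (Fin k → κ) := fun x i => x i ^ p ^ s
  have hF : ∀ j x, F.IsPeriodicPt j x ↔ ∀ i, x i ^ (p ^ s) ^ j = x i := by
    intro j x
    have : F^[j] x = fun i => x i ^ (p ^ s) ^ j := by
      induction j with
      | zero => simp
      | succ j ih =>
        rw [Function.iterate_succ_apply', ih]
        ext i
        simp only [F]
        rw [← pow_mul, ← pow_succ]
    rw [Function.IsPeriodicPt, Function.IsFixedPt, this, funext_iff]
  have hset : ∀ j, 0 < j → Nat.card {x | F.IsPeriodicPt j x} = (p ^ s) ^ (k * j) := by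
    intro j hj
    let e : {x | F.IsPeriodicPt j x} ≃ (Fin k → {y : κ // y ^ p ^ (s * j) = y}) :=
      { toFun := fun x i => ⟨x.1 i, by rw [pow_mul]; exact (hF j x.1).1 x.2 i⟩
        invFun := fun x => ⟨fun i => x i, (hF j _).2 fun i => by rw [← pow_mul]; exact (x i).2⟩
        left_inv := fun x => rfl
        right_inv := fun x => rfl }
    rw [Nat.card_congr e, Nat.card_fun, card_residueField_pow_eq_self A (by positivity),
      Nat.card_fin, ← pow_mul, ← pow_mul]
    ring
  have hpos : 0 < p := (Fact.out : p.Prime).pos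
  have hfin : ∀ j, 0 < j → {x | F.IsPeriodicPt j x}.Finite := fun j hj =>
    Nat.finite_of_card_ne_zero (by rw [hset j hj]; positivity)
  have := card_exists_isPeriodicPt F ((p ^ s) ^ k) hfin
    (fun j hj => by rw [← Nat.card_coe_set_eq, hset j hj, pow_mul]) d
  simp only [hF] at this
  refine ⟨this.1, this.2.trans ?_⟩
  refine Finset.sum_congr rfl fun j _ => Finset.sum_congr rfl fun i _ => ?_
  push_cast
  rw [← pow_mul, ← pow_mul, ← pow_mul]
  ring

/-! ### Assembling the bound -/

/-- In the presence of a Frobenius lift, a polynomial with `k + 1` terms has few zeros of small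
Frobenius period. -/
theorem IsFrobeniusLift.card_zeros_le {E : Type*} [Field E] [IsAlgClosed E] {p s : ℕ}
    [Fact p.Prime] [CharP E p] {A : ValuationSubring E} {φ : E →+* E}
    (h : IsFrobeniusLift A φ (p ^ s)) (hs : s ≠ 0) {f : E[X]} {k : ℕ}
    (hk : f.support.card = k + 1) (d : ℕ) :
    ({z | f.eval z = 0 ∧ ∃ j ∈ Finset.Icc 1 d, (φ ^ j) z = z}.ncard : ℤ) ≤
      ∑ j ∈ Finset.Icc 1 d, ∑ i ∈ j.divisors,
        ArithmeticFunction.moebius (j / i) * ((p ^ s : ℕ) : ℤ) ^ (i * k) := by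
  obtain ⟨addr, hinj, hfix⟩ := exists_address h hs hk
  obtain ⟨hfin, hcard⟩ := card_exists_frobenius_fixed (p := p) A hs k d
  rw [← hcard, Nat.cast_le]
  refine Set.ncard_le_ncard_of_injOn addr (fun z hz => ?_) (hinj.mono fun z hz => hz.1) hfin
  obtain ⟨hz0, j, hj, hz⟩ := hz
  exact ⟨j, hj, hfix z hz0 j hz⟩

/-- An endomorphism over `K` of an algebraic extension returns every element to itself after at
most `deg` steps. -/
lemma exists_pow_apply_eq_self {K E : Type*} [Field K] [Field E] [Algebra K E]
    [Algebra.IsAlgebraic K E] (φ : E →ₐ[K] E) (z : E) :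
    ∃ j ∈ Finset.Icc 1 (minpoly K z).natDegree, ((φ : E →+* E) ^ j) z = z := by
  classical
  have hint : IsIntegral K z := Algebra.IsIntegral.isIntegral z
  have hP : (minpoly K z).map (algebraMap K E) ≠ 0 :=
    (Polynomial.map_ne_zero_iff (algebraMap K E).injective).2 (minpoly.ne_zero hint)
  -- The whole orbit lies among the at most deg z conjugates of z, so two of the first deg z + 1
  -- iterates coincide, and injectivity cancels the common power.
  have hroot : ∀ i, ((φ : E →+* E) ^ i) z ∈ ((minpoly K z).map (algebraMap K E)).roots.toFinset := by
    intro i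
    rw [Multiset.mem_toFinset, mem_roots hP, IsRoot, eval_map_algebraMap]
    induction i with
    | zero => simp
    | succ i ih =>
      rw [IsFrobeniusLift.pow_succ_apply, RingHom.coe_coe, aeval_algHom_apply, ih, map_zero]
  have hcard : ((minpoly K z).map (algebraMap K E)).roots.toFinset.card <
      (Finset.range ((minpoly K z).natDegree + 1)).card := by
    rw [Finset.card_range, Nat.lt_succ_iff]
    exact (Multiset.toFinset_card_le _).trans ((card_roots' _).trans natDegree_map_le)
  obtain ⟨a, ha, b, hb, hab, heq⟩ := Finset.exists_ne_map_eq_of_card_lt_of_maps_to hcard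
    (fun i _ => hroot i)
  wlog hlt : a < b generalizing a b
  · exact this b hb a ha hab.symm heq.symm (lt_of_le_of_ne (not_lt.1 hlt) hab.symm)
  refine ⟨b - a, Finset.mem_Icc.2 ⟨by lia, by have := Finset.mem_range.1 hb; lia⟩, ?_⟩
  apply ((φ : E →+* E) ^ a).injective
  rw [← IsFrobeniusLift.pow_add_apply, Nat.add_sub_cancel' hlt.le]
  exact heq.symm

theorem theorem2 {K : Type*} [Field K] (p : ℕ) (hp : 0 < p) [CharP K p]
    {Γ₀ : Type*} [LinearOrderedCommGroupWithZero Γ₀] (v : Valuation K Γ₀)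
    (hfin : Finite (IsLocalRing.ResidueField v.valuationSubring))
    (q : ℕ) (hq : Nat.card (IsLocalRing.ResidueField v.valuationSubring) = q)
    {Kbar : Type*} [Field Kbar] [Algebra K Kbar] [IsAlgClosure K Kbar]
    (d : ℕ) (hd : 1 ≤ d) (k : ℕ) (f : Polynomial K) (hf : f.support.card = k + 1) :
    {z : Kbar | Polynomial.aeval z f = 0 ∧ (minpoly K z).natDegree ≤ d}.Finite ∧
      (({z : Kbar | Polynomial.aeval z f = 0 ∧ (minpoly K z).natDegree ≤ d}.ncard : ℕ) : ℤ) ≤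
        ∑ j ∈ Finset.Icc 1 d, ∑ i ∈ j.divisors,
          ArithmeticFunction.moebius (j / i) * (q : ℤ) ^ (i * k) := by
  classical
  have hprime : Fact p.Prime := ⟨(CharP.char_is_prime_or_zero K p).resolve_right hp.ne'⟩
  have : IsAlgClosed Kbar := IsAlgClosure.isAlgClosed K
  have : Algebra.IsAlgebraic K Kbar := IsAlgClosure.isAlgebraic
  have : CharP Kbar p := charP_of_injective_algebraMap (algebraMap K Kbar).injective p
  let O := v.valuationSubring
  have : CharP O p := RingHom.charP O.subtype Subtype.val_injective p
  have : CharP (IsLocalRing.ResidueField O) p := charP_of_injective_ringHom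
    (f := (IsLocalRing.residue O).comp (ZMod.castHom dvd_rfl O)) (RingHom.injective _) p
  have : Fintype (IsLocalRing.ResidueField O) := Fintype.ofFinite _
  obtain ⟨s, -, hs⟩ := FiniteField.card (IsLocalRing.ResidueField O) p
  rw [← Nat.card_eq_fintype_card, hq] at hs
  have hO : ∀ x ∈ O, O.valuation (x ^ p ^ (s : ℕ) - x) < 1 := by
    intro x hx
    refine (O.valuation_lt_one_iff (⟨x, hx⟩ ^ p ^ (s : ℕ) - ⟨x, hx⟩)).1 (Ideal.Quotient.eq.1 ?_)
    have := FiniteField.pow_card (IsLocalRing.residue O ⟨x, hx⟩)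
    rw [← Nat.card_eq_fintype_card, hq, hs, ← map_pow] at this
    exact this
  obtain ⟨A, φ, hφ⟩ := exists_valuationSubring_frobenius (E := Kbar) p s O hO
  have hlift : IsFrobeniusLift A (φ.toAlgHom : Kbar →+* Kbar) (p ^ (s : ℕ)) :=
    ⟨hφ, fun x => by
      obtain ⟨j, hj, hx⟩ := exists_pow_apply_eq_self φ.toAlgHom x
      exact ⟨j, (Finset.mem_Icc.1 hj).1, hx⟩⟩
  have hfK : (f.map (algebraMap K Kbar)).support.card = k + 1 := by
    rw [Polynomial.support_map_of_injective _ (algebraMap K Kbar).injective, hf]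
  have hf0 : f.map (algebraMap K Kbar) ≠ 0 := by
    intro h0
    simp [h0] at hfK
  have hzeros : {z : Kbar | (f.map (algebraMap K Kbar)).eval z = 0}.Finite :=
    (f.map (algebraMap K Kbar)).roots.toFinset.finite_toSet.subset fun z hz => by
      simpa [hf0] using hz
  refine ⟨hzeros.subset fun z hz => ?_, ?_⟩
  · rw [Set.mem_ofPred_eq, Polynomial.eval_map_algebraMap]
    exact hz.1
  · rw [hs]
    refine le_trans (Nat.cast_le.2 (Set.ncard_le_ncard (fun z hz => ?_)
      (hzeros.subset fun z hz => hz.1))) (hlift.card_zeros_le s.ne_zero hfK d)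
    obtain ⟨j, hj, hz'⟩ := exists_pow_apply_eq_self φ.toAlgHom z
    refine ⟨?_, j, ?_, hz'⟩
    · rw [Polynomial.eval_map_algebraMap]
      exact hz.1
    · have h1 := Finset.mem_Icc.1 hj
      exact Finset.mem_Icc.2 ⟨h1.1, h1.2.trans hz.2⟩
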